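/- \textbf{Theorem.} Let $p\equiv 1\pmod 3$ be a prime, $g$ a primitive element of $\mathbb F_p$, $m\ge 2$, $h\in\{0,1,2\}$ and $a\in\mathbb F_p$. Let $\zeta=e^{2\pi i/3}$, let $\chi$ be the multiplicative character of $\mathbb F_p$ of order $3$ with $\chi(g)=\zeta$, let $a_3,b_3$ be the integers with $$a_3^2+3b_3^2=p,\qquad a_3\equiv -1\pmod 3,\qquad 3b_3\equiv(2g^{(p-1)/3}+1)a_3\pmod p,$$ and put $\pi=\chi(2)(a_3+i\,b_3\sqrt3)$. \emph{(1)} For $t\mid m$ let $N_t$ be the number of $x\in\mathbb F_{p^t}\subseteq\mathbb F_{p^m}$ such that the trace of $x$ from $\mathbb F_{p^m}$ to $\mathbb F_p$ is $a$ and the norm of $x$ from $\mathbb F_{p^m}$ to $\mathbb F_p$ lies in $g^h\langle g^3\rangle$. Put $d=\gcd(\frac mt,3)$ and $l=\gcd(t,\frac3d)$, and assume that $p\nmid\frac mt$ and $d\mid h$. Let $i_0$ be the integer with $0\le i_0<\frac3d$ and $\frac{m}{dt}i_0\equiv\frac hd\pmod{\frac3d}$. For $a\neq0$ put $a_0=-\frac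 mt\,a^{-1}\in\mathbb F_p$ (the integer $\frac mt$ being reduced modulo $p$) and, if $3\nmid t$, $$Q_{t,3}=\begin{cases}p^{\frac{t-1}3}\pi^{\frac{t-1}3}\,\overline{\chi}(a_0)\,\zeta^{2i_0}&\text{if }t\equiv1\pmod 3,\\ p^{\frac{t-2}3}\pi^{\frac{t+1}3}\,\chi(a_0)\,\zeta^{2i_0}&\text{if }t\equiv2\pmod 3.\end{cases}$$ Then $(d,l)\in\{(1,1),(1,3),(3,1)\}$, and $N_t$ is as follows. If $a=0$: $$N_t=\begin{cases}\frac13(p^{t-1}-1)&(d,l)=(1,1),\\ \frac13\bigl(p^{t-1}-1-2(-1)^tp^{\frac{t-3}3}(p-1)\operatorname{Re}(\pi^{\frac t3}\zeta^{2i_0})\bigr)&(d,l)=(1,3),\\ p^{t-1}-1&(d,l)=(3,1).\end{cases}$$ If $a\ne0$: $$N_t=\begin{cases}\frac13\bigl(p^{t-1}-2(-1)^t\operatorname{Re}Q_{t,3}\bigr)&(d,l)=(1,1),\\ \frac13\bigl(p^{t-1}+2(-1)^tp^{\frac{t-3}3}\operatorname{Re}(\pi^{\frac t3}\zeta^{2i_0})\bigr)&(d,l)=(1,3),\\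 p^{t-1}&(d,l)=(3,1).\end{cases}$$ \emph{(2)} Let $P_m(a,3,h)$ be the number of irreducible polynomials $x^m-ax^{m-1}+\cdots+(-1)^mb\in\mathbb F_p[x]$ with $b\in g^h\langle g^3\rangle$, and suppose that $m>3$ is prime. Then $$P_m(0,3,h)=\begin{cases}\frac13(p^{p-2}-1)&m=p,\\ \frac1{3m}(p^{m-1}-1)&m\neq p,\end{cases}$$ and for $a\neq0$ $$P_m(a,3,h)=\begin{cases}\frac1{3p}\bigl(p^{p-1}+2p^{\frac{p-1}3}\operatorname{Re}(\pi^{\frac{p-1}3}\chi(a)\zeta^{2h})\bigr)&m=p,\\ \frac1{3m}\bigl(p^{m-1}-1+2\operatorname{Re}L_m\bigr)&m\ne p,\end{cases}$$ where $$L_m=\begin{cases}\bigl((p\pi)^{\frac{m-1}3}-\overline\chi(m)\bigr)\chi(a)\zeta^{2h}&m\equiv1\pmod 3,\\ \bigl(p^{\frac{m-2}3}\pi^{\frac{m+1}3}\chi(a)\zeta^h-\overline\chi(m)\bigr)\chi(a)\zeta^h&m\equiv2\pmod 3.\end{cases}$$ -/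

import Mathlib

open Polynomial

noncomputable section

namespace NormTrace

/-- The coset `g ^ h ⟨g ^ s⟩` of the multiplicative group, as a set of elements of the field. -/
def coset {F : Type*} [Field F] (g : Fˣ) (s h : ℕ) : Set F :=
  {b | ∃ u ∈ Subgroup.zpowers (g ^ s), b = ((g ^ h * u : Fˣ) : F)}

/-- `P_m(a, s, h)`: the number of the irreducible polynomials
`x ^ m - a x ^ (m - 1) + ⋯ + (-1) ^ m b` over `F` with `b` in the coset `g ^ h ⟨g ^ s⟩`. -/
def numIrreducible {F : Type*} [Field F] (g : Fˣ) (m : ℕ) (a : F) (s h : ℕ) : ℕ :=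
  Set.ncard {f : F[X] | f.Monic ∧ Irreducible f ∧ f.natDegree = m ∧
    f.coeff (m - 1) = -a ∧ ∃ b ∈ coset g s h, f.coeff 0 = (-1) ^ m * b}

/-- `S_t(a, s, h)`: the elements `x` of the intermediate field `E` (the field with `q ^ t` elements)
whose trace from `L` (the field with `q ^ m` elements) to `F` is `a` and whose norm from `L` to `F`
lies in the coset `g ^ h ⟨g ^ s⟩`. -/
def solSet {F L : Type*} [Field F] [Field L] [Algebra F L] (g : Fˣ) (E : IntermediateField F L)
    (a : F) (s h : ℕ) : Set L :=
  {x | x ∈ E ∧ Algebra.trace F L x = a ∧ Algebra.norm F x ∈ coset g s h}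

/-- `N_t = N_t(a, s, h)`, the number of elements of `S_t(a, s, h)`. -/
def numSol {F L : Type*} [Field F] [Field L] [Algebra F L] (g : Fˣ) (E : IntermediateField F L)
    (a : F) (s h : ℕ) : ℕ :=
  (solSet g E a s h).ncard

/-- `d = gcd(m / t, s)`. -/
def parD (m t s : ℕ) : ℕ := Nat.gcd (m / t) s

/-- `l = gcd(t, s / d)`. -/
def parL (m t s : ℕ) : ℕ := Nat.gcd t (s / parD m t s)

/-- `i` is the solution `i₀` of `(m / (d t)) i ≡ h / d (mod s / d)` with `0 ≤ i < s / d`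
(used only when `t ∣ m` and `d ∣ h`, so that all the divisions are exact). -/
def IsBaseIndex (m t s h i : ℕ) : Prop :=
  i < s / parD m t s ∧ m / t / parD m t s * i ≡ h / parD m t s [MOD s / parD m t s]

/-- `ζ = exp (2 π i / 3)`. -/
def zeta : ℂ := Complex.exp (2 * Real.pi * Complex.I / 3)

/-- `π = χ(2) (a₃ + i b₃ √3)`. -/
def piThree {p : ℕ} (χ : MulChar (ZMod p) ℂ) (a₃ b₃ : ℤ) : ℂ :=
  χ 2 * ((a₃ : ℂ) + Complex.I * (b₃ : ℂ) * (Real.sqrt 3 : ℂ))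

/-- `a₀ = -m / (t a)`; the integer `m / t` is formed first and then reduced modulo `p`, since `p`
may divide `t`. -/
def aZero {p : ℕ} [Fact p.Prime] (m t : ℕ) (a : ZMod p) : ZMod p :=
  -((m / t : ℕ) : ZMod p) / a

/-- `Q_{t,3}`, for `t` not divisible by `3`, as a function of `π`, `a₀` and `i₀`. -/
def QThree {p : ℕ} (χ : MulChar (ZMod p) ℂ) (π : ℂ) (t : ℕ) (a₀ : ZMod p) (i₀ : ℕ) : ℂ :=
  if t % 3 = 1 then
    (p : ℂ) ^ ((t - 1) / 3) * π ^ ((t - 1) / 3) * (starRingEnd ℂ) (χ a₀) * zeta ^ (2 * i₀)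
  else
    (p : ℂ) ^ ((t - 2) / 3) * π ^ ((t + 1) / 3) * χ a₀ * zeta ^ (2 * i₀)

/-- `L_m`, for `m` not divisible by `3`. -/
def LThree {p : ℕ} (χ : MulChar (ZMod p) ℂ) (π : ℂ) (m : ℕ) (a : ZMod p) (h : ℕ) : ℂ :=
  if m % 3 = 1 then
    (((p : ℂ) * π) ^ ((m - 1) / 3) - (starRingEnd ℂ) (χ (m : ZMod p))) * χ a * zeta ^ (2 * h)
  else
    ((p : ℂ) ^ ((m - 2) / 3) * π ^ ((m + 1) / 3) * χ a * zeta ^ h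
      - (starRingEnd ℂ) (χ (m : ZMod p))) * χ a * zeta ^ h

end NormTrace

end

/-!
Let `S(c)` be the sum of `χ (N x)` over the elements `x` of trace `c` in the field `K` of degree `t`
over `𝔽_p`. Orthogonality of `1, χ, χ²` (`three_mul_indicator`) turns the number of `x` with trace
`c` and `χ (N x) = ζ ^ i` into `(p ^ (t - 1) - [c = 0] + 2 Re (ζ ^ (2 i) S(c))) / 3`, which is
`three_mul_ncard_trace_norm`. So everything rests on `S(c)`.

Fourier inversion in the trace writes `p S(c)` as a sum over `y ∈ 𝔽_p` of Gauss sums of `K` attached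
to the lifts of `χ` and of the additive character `ψ(y ·)` (`natCast_mul_traceSum`). By the
Hasse–Davenport relation (`sum_norm_trace_eq_gaussSum_pow`) these are `(-1) ^ (t + 1)` times `t`-th
powers of Gauss sums of `𝔽_p`, and the remaining sum over `y` is elementary. Since
`G(χ) ^ 3 = p J(χ, χ)` and `G(χ) G(χ⁻¹) = p`, in each class of `t` modulo `3` the result is a
monomial in `p`, the Jacobi sum `J(χ, χ)` and a power of `χ(c)` (with a factor `p [c = 0] - 1` when
`3 ∣ t`).

The Hasse–Davenport relation is proved with the completely multiplicative function `polyChar` on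
monic polynomials. Its sums over the monic polynomials of degree `0`, `1` and `n ≥ 2` are `1`, the
Gauss sum and `0`. The identity expressing the degree as a sum over prime-power divisors
(`natDegree_eq_sum_prime_powers`) then gives the recursion `A (n + 1) = -G A n` for the prime power
sums `A n` (`primePowerSum`), and grouping the elements of an extension of degree `n` by minimal
polynomial identifies `A n` with its Gauss sum.

The identity `J(χ, χ) = π` (`jacobiSum_eq_piThree`) holds because `χ(4) J(χ, χ) = J(χ, η)`, with `η`
the quadratic character, lies in `ℤ[√-3]`, has norm `p`, is `-1` modulo `3` in its rational part,
and vanishes modulo the prime above `p` at which `ζ` reduces to `g ^ ((p - 1) / 3)`. These properties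
single out `a₃ + b₃ √-3`.

For an intermediate field the trace and norm from the top are a multiple and a power of those of the
intermediate field, which gives the numbers `N_t`. For a prime degree `m` each irreducible
polynomial has `m` roots outside the prime field, so that `m P_m` is the count in
degree `m` minus the contribution of the prime field (`mul_numIrreducible_add`).
-/

noncomputable section

namespace NormTrace

/-! ### Minimal polynomials over finite fields and monic polynomials -/

section Fibers
variable (F K : Type*) [Field F] [Field K] [Algebra F K] [Finite K]

/-- An irreducible polynomial whose degree divides the degree of an extension of finite fields is
the minimal polynomial of exactly `natDegree` elements of the extension. -/
theorem ncard_minpoly_eq {P : F[X]} (hP : P.Monic) (hi : Irreducible P)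
    (hd : P.natDegree ∣ Module.finrank F K) : {x : K | minpoly F x = P}.ncard = P.natDegree := by
  classical
  have : Finite F := Finite.of_injective _ (algebraMap F K).injective
  have := Fintype.ofFinite F
  have := Fintype.ofFinite K
  have hsplit : (P.map (algebraMap F K)).Splits := by
    have h1 := (hi.natDegree_dvd_iff_dvd_X_pow_card_pow_sub_X).1 hd
    rw [← Module.natCard_eq_pow_finrank (K := F), Nat.card_eq_fintype_card] at h1
    have h2 : ((X ^ Fintype.card K - X : F[X]).map (algebraMap F K)).Splits :=
      (FiniteField.isSplittingField_sub K F).splits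
    refine h2.of_dvd ?_ (Polynomial.map_dvd (algebraMap F K) h1)
    exact Polynomial.map_ne_zero (FiniteField.X_pow_card_sub_X_ne_zero F Fintype.one_lt_card)
  have hsep : P.Separable := PerfectField.separable_of_irreducible hi
  rw [← card_rootSet_eq_natDegree hsep hsplit, ← Nat.card_eq_fintype_card, Nat.card_coe_set_eq]
  congr 1
  ext x
  rw [Set.mem_ofPred_eq, mem_rootSet_of_ne hi.ne_zero]
  constructor
  · rintro rfl
    exact minpoly.aeval F x
  · intro h
    exact (minpoly.eq_of_irreducible_of_monic hi h hP).symm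

variable {K}

theorem natDegree_minpoly_pos (x : K) : 0 < (minpoly F x).natDegree := by
  have : Finite F := Finite.of_injective _ (algebraMap F K).injective
  exact minpoly.natDegree_pos (Algebra.IsIntegral.isIntegral x)

theorem finrank_eq_natDegree_mul_finrank (x : K) :
    Module.finrank F K =
      (minpoly F x).natDegree * Module.finrank (IntermediateField.adjoin F {x}) K := by
  have : Finite F := Finite.of_injective _ (algebraMap F K).injective
  rw [← Module.finrank_mul_finrank F (IntermediateField.adjoin F {x}) K,
    IntermediateField.adjoin.finrank (Algebra.IsIntegral.isIntegral x)]

theorem norm_eq_minpoly_pow (x : K) :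
    Algebra.norm F x = ((-1) ^ (minpoly F x).natDegree * (minpoly F x).coeff 0) ^
      (Module.finrank F K / (minpoly F x).natDegree) := by
  have : Finite F := Finite.of_injective _ (algebraMap F K).injective
  have hx : IsIntegral F x := Algebra.IsIntegral.isIntegral x
  have h := Algebra.PowerBasis.norm_gen_eq_coeff_zero_minpoly
    (IntermediateField.adjoin.powerBasis hx)
  rw [IntermediateField.adjoin.powerBasis_gen, IntermediateField.adjoin.powerBasis_dim,
    IntermediateField.minpoly_gen] at h
  rw [Algebra.norm_eq_norm_adjoin, h]
  congr 1
  rw [finrank_eq_natDegree_mul_finrank F x, Nat.mul_div_cancel_left _ (natDegree_minpoly_pos F x)]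

theorem trace_eq_smul_minpoly (x : K) :
    Algebra.trace F K x = (Module.finrank F K / (minpoly F x).natDegree) •
      -(minpoly F x).nextCoeff := by
  have : Finite F := Finite.of_injective _ (algebraMap F K).injective
  have hx : IsIntegral F x := Algebra.IsIntegral.isIntegral x
  have h := (IntermediateField.adjoin.powerBasis hx).trace_gen_eq_nextCoeff_minpoly
  rw [IntermediateField.adjoin.powerBasis_gen, IntermediateField.minpoly_gen] at h
  rw [trace_eq_trace_adjoin, h]
  congr 1
  rw [finrank_eq_natDegree_mul_finrank F x, Nat.mul_div_cancel_left _ (natDegree_minpoly_pos F x)]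

end Fibers

section Monics
variable (F : Type*) [Field F]

/-- Monic polynomials of degree `n` are given by their `n` lower coefficients. -/
def monicEquivCoeff (n : ℕ) : {f : F[X] // f.Monic ∧ f.natDegree = n} ≃ (Fin n → F) :=
  (monicEquivDegreeLT n).trans (degreeLTEquiv F n).toEquiv

theorem monicEquivCoeff_apply (n : ℕ) (f : {f : F[X] // f.Monic ∧ f.natDegree = n}) (i : Fin n) :
    monicEquivCoeff F n f i = f.1.coeff i := by
  obtain ⟨f, hf, rfl⟩ := f
  change (f.eraseLead).coeff i = f.coeff i
  exact eraseLead_coeff_of_ne _ (by have := i.2; lia)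

variable {F} in
theorem coeff_monicEquivCoeff_symm (n : ℕ) (v : Fin n → F) (i : Fin n) :
    ((monicEquivCoeff F n).symm v).1.coeff i = v i := by
  rw [← monicEquivCoeff_apply, Equiv.apply_symm_apply]

theorem finite_monic [Finite F] (n : ℕ) : {f : F[X] | f.Monic ∧ f.natDegree = n}.Finite :=
  Finite.of_equiv _ (monicEquivCoeff F n).symm

/-- The finite set of the monic polynomials of degree `n` over a finite field. -/
def monics [Finite F] (n : ℕ) : Finset F[X] := (finite_monic F n).toFinset

variable {F}

@[simp]
theorem mem_monics [Finite F] {n : ℕ} {f : F[X]} : f ∈ monics F n ↔ f.Monic ∧ f.natDegree = n := by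
  simp [monics]

theorem sum_monics [Fintype F] {C : Type*} [AddCommMonoid C] (n : ℕ) (φ : F[X] → C) :
    ∑ f ∈ monics F n, φ f = ∑ v : Fin n → F, φ ((monicEquivCoeff F n).symm v).1 := by
  rw [← Finset.sum_coe_sort]
  refine Fintype.sum_equiv (((Equiv.refl F[X]).subtypeEquiv (by simp)).trans
    (monicEquivCoeff F n)) _ _ fun x => ?_
  simp only [Equiv.trans_apply, Equiv.symm_apply_apply]
  rfl

variable {C : Type*} [CommRing C] (χ : MulChar F C) (ψ : AddChar F C)

/-- The completely multiplicative function
`x ^ n - c₁ x ^ (n - 1) + ⋯ + (-1) ^ n cₙ ↦ χ(cₙ) ψ(c₁)` on monic polynomials. -/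
def polyChar (f : F[X]) : C := χ ((-1) ^ f.natDegree * f.coeff 0) * ψ (-f.nextCoeff)

theorem polyChar_one : polyChar χ ψ 1 = 1 := by
  simp [polyChar, nextCoeff]

theorem polyChar_mul {f g : F[X]} (hf : f.Monic) (hg : g.Monic) :
    polyChar χ ψ (f * g) = polyChar χ ψ f * polyChar χ ψ g := by
  rw [polyChar, hf.natDegree_mul hg, hf.nextCoeff_mul hg, mul_coeff_zero, pow_add, neg_add,
    AddChar.map_add_eq_mul, mul_mul_mul_comm, map_mul, polyChar, polyChar]
  ring

theorem polyChar_pow {f : F[X]} (hf : f.Monic) (j : ℕ) :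
    polyChar χ ψ (f ^ j) = polyChar χ ψ f ^ j := by
  induction j with
  | zero => simp [polyChar_one]
  | succ j ih => rw [pow_succ, polyChar_mul χ ψ (hf.pow j) hf, ih, pow_succ]

theorem sum_polyChar_zero [Finite F] : ∑ f ∈ monics F 0, polyChar χ ψ f = 1 := by
  have : monics F 0 = {1} := by
    ext f
    rw [mem_monics, Finset.mem_singleton]
    constructor
    · rintro ⟨h1, h2⟩
      exact h1.natDegree_eq_zero.1 h2
    · rintro rfl
      exact ⟨monic_one, natDegree_one⟩
  rw [this, Finset.sum_singleton, polyChar_one]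

theorem polyChar_monicEquivCoeff_symm (n : ℕ) (v : Fin (n + 1) → F) :
    polyChar χ ψ ((monicEquivCoeff F (n + 1)).symm v).1 =
      χ ((-1) ^ (n + 1) * v 0) * ψ (-v (Fin.last n)) := by
  have h := ((monicEquivCoeff F (n + 1)).symm v).2.2
  rw [polyChar, nextCoeff_of_natDegree_pos (by lia), h, Nat.add_sub_cancel]
  congr 3
  · rw [← coeff_monicEquivCoeff_symm (n + 1) v 0]; rfl
  · rw [← coeff_monicEquivCoeff_symm (n + 1) v (Fin.last n)]; rfl

variable [Fintype F]

theorem sum_polyChar_one : ∑ f ∈ monics F 1, polyChar χ ψ f = gaussSum χ ψ := by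
  rw [sum_monics, gaussSum]
  refine Fintype.sum_equiv ((Equiv.funUnique (Fin 1) F).trans (Equiv.neg F)) _ _ fun v => ?_
  rw [polyChar_monicEquivCoeff_symm χ ψ 0 v]
  simp

/-- In degree at least two the constant coefficient and the coefficient carrying the trace are
independent, so that the sum factors through the sum of a nontrivial character. -/
theorem sum_polyChar_eq_zero [IsDomain C] (hχ : χ ≠ 1) (n : ℕ) :
    ∑ f ∈ monics F (n + 2), polyChar χ ψ f = 0 := by
  classical
  rw [sum_monics]
  simp only [polyChar_monicEquivCoeff_symm]
  obtain ⟨u, hu⟩ := MulChar.ne_one_iff.1 hχ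
  let e : (Fin (n + 2) → F) ≃ (Fin (n + 2) → F) :=
    Equiv.piCongrRight fun i => if i = 0 then Units.mulLeft u else Equiv.refl F
  have h : ∑ v : Fin (n + 2) → F, χ ((-1) ^ (n + 2) * v 0) * ψ (-v (Fin.last (n + 1))) =
      χ u * ∑ v : Fin (n + 2) → F, χ ((-1) ^ (n + 2) * v 0) * ψ (-v (Fin.last (n + 1))) := by
    -- Scale the constant coefficient by a unit at which `χ` is nontrivial.
    rw [Finset.mul_sum, ← e.sum_comp]
    refine Finset.sum_congr rfl fun v _ => ?_
    have h0 : e v 0 = u * v 0 := by simp [e]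
    have h1 : e v (Fin.last (n + 1)) = v (Fin.last (n + 1)) := by simp [e]
    rw [h0, h1, mul_left_comm, map_mul, mul_assoc]
  have h2 : (χ u - 1) * ∑ v : Fin (n + 2) → F,
      χ ((-1) ^ (n + 2) * v 0) * ψ (-v (Fin.last (n + 1))) = 0 := by
    rw [sub_mul, ← h]; ring
  exact (mul_eq_zero.1 h2).resolve_left (sub_ne_zero.2 hu)

end Monics

/-! ### The Hasse–Davenport relation -/

section HasseDavenport
variable (F : Type*) [Field F]

open scoped Classical in
/-- The monic irreducible polynomials of degree at most `n` over a finite field. -/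
def monicIrreducibles [Finite F] (n : ℕ) : Finset F[X] :=
  ((Finset.range (n + 1)).biUnion (monics F)).filter Irreducible

variable {F}

theorem mem_monicIrreducibles [Finite F] {n : ℕ} {P : F[X]} :
    P ∈ monicIrreducibles F n ↔ P.Monic ∧ Irreducible P ∧ P.natDegree ≤ n := by
  simp only [monicIrreducibles, Finset.mem_filter, Finset.mem_biUnion, Finset.mem_range, mem_monics]
  constructor
  · rintro ⟨⟨d, hd, h1, rfl⟩, h2⟩
    exact ⟨h1, h2, by lia⟩
  · rintro ⟨h1, h2, h3⟩
    exact ⟨⟨_, by lia, h1, rfl⟩, h2⟩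

open scoped Classical in
open UniqueFactorizationMonoid in
/-- The degree of a monic polynomial is the sum of `natDegree P` over its divisors `P ^ j`, `1 ≤ j`,
that are powers of monic irreducibles: the polynomial form of `log = Λ * 1`. -/
theorem natDegree_eq_sum_prime_powers [Finite F] {n : ℕ} {f : F[X]} (hf : f ∈ monics F n) :
    n = ∑ P ∈ monicIrreducibles F n, ∑ j ∈ Finset.Icc 1 n,
      if P ^ j ∣ f then P.natDegree else 0 := by
  obtain ⟨hm, hn⟩ := mem_monics.1 hf
  have hprod : (normalizedFactors f).prod = f := by
    rw [prod_normalizedFactors_eq, hm.normalize_eq_self]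
    exact hm.ne_zero
  have hmem : ∀ P ∈ normalizedFactors f, P.Monic ∧ Irreducible P := fun P hP => by
    have := (Polynomial.mem_normalizedFactors_iff hm.ne_zero).1 hP
    exact ⟨this.2.1, this.1⟩
  have hcount : ∀ P ∈ monicIrreducibles F n, ∑ j ∈ Finset.Icc 1 n,
      (if P ^ j ∣ f then P.natDegree else 0) =
        (normalizedFactors f).count P * P.natDegree := by
    intro P hP
    obtain ⟨h1, h2, h3⟩ := mem_monicIrreducibles.1 hP
    have hdvd : ∀ j, P ^ j ∣ f ↔ j ≤ (normalizedFactors f).count P := fun j => by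
      rw [pow_dvd_iff_le_emultiplicity, emultiplicity_eq_count_normalizedFactors h2 hm.ne_zero,
        h1.normalize_eq_self, Nat.cast_le]
    have hle : (normalizedFactors f).count P ≤ n := by
      have h4 := natDegree_le_of_dvd ((hdvd _).2 le_rfl) hm.ne_zero
      rw [natDegree_pow, hn] at h4
      exact (Nat.le_mul_of_pos_right _ h2.natDegree_pos).trans h4
    rw [← Finset.sum_filter, Finset.sum_const, smul_eq_mul]
    congr 1
    have : (Finset.Icc 1 n).filter (fun j => P ^ j ∣ f) =
        Finset.Icc 1 ((normalizedFactors f).count P) := by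
      ext j
      simp only [Finset.mem_filter, Finset.mem_Icc, hdvd]
      lia
    rw [this, Nat.card_Icc, Nat.add_sub_cancel]
  rw [Finset.sum_congr rfl hcount]
  conv_lhs => rw [← hn, ← hprod, natDegree_multiset_prod_of_monic _ fun P hP => (hmem P hP).1,
    Finset.sum_multiset_map_count]
  refine Finset.sum_subset (fun P hP => ?_) fun P _ hP => ?_
  · rw [Multiset.mem_toFinset] at hP
    refine mem_monicIrreducibles.2 ⟨(hmem P hP).1, (hmem P hP).2, ?_⟩
    rw [← hn]
    exact natDegree_le_of_dvd (dvd_of_mem_normalizedFactors hP) hm.ne_zero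
  · rw [Multiset.mem_toFinset] at hP
    rw [Multiset.count_eq_zero_of_notMem hP, zero_smul]

variable {C : Type*} [CommRing C] (χ : MulChar F C) (ψ : AddChar F C)

open scoped Classical in
theorem sum_polyChar_dvd [Finite F] {Q : F[X]} (hQ : Q.Monic) (n : ℕ) :
    ∑ f ∈ monics F n with Q ∣ f, polyChar χ ψ f =
      if Q.natDegree ≤ n then polyChar χ ψ Q * ∑ g ∈ monics F (n - Q.natDegree), polyChar χ ψ g
      else 0 := by
  split_ifs with h
  · rw [Finset.mul_sum]
    symm
    refine Finset.sum_bij (fun g _ => Q * g) ?_ ?_ ?_ ?_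
    · intro g hg
      obtain ⟨h1, h2⟩ := mem_monics.1 hg
      rw [Finset.mem_filter, mem_monics, hQ.natDegree_mul h1]
      exact ⟨⟨hQ.mul h1, by lia⟩, dvd_mul_right _ _⟩
    · intro g _ g' _ h
      exact mul_left_cancel₀ hQ.ne_zero h
    · intro f hf
      rw [Finset.mem_filter, mem_monics] at hf
      obtain ⟨⟨h1, h2⟩, g, rfl⟩ := hf
      have hg := hQ.of_mul_monic_left h1
      refine ⟨g, ?_, rfl⟩
      rw [hQ.natDegree_mul hg] at h2
      exact mem_monics.2 ⟨hg, by lia⟩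
    · intro g hg
      rw [polyChar_mul χ ψ hQ (mem_monics.1 hg).1]
  · refine Finset.sum_eq_zero fun f hf => ?_
    rw [Finset.mem_filter, mem_monics] at hf
    have := natDegree_le_of_dvd hf.2 hf.1.1.ne_zero
    lia

/-- The sum of `natDegree P * λ(P ^ j)` over the powers `P ^ j` of degree `n` of monic irreducibles,
where `λ` is `polyChar`: a coefficient of the logarithmic derivative of the `L`-function of `λ`. -/
def primePowerSum [Finite F] (n : ℕ) : C :=
  ∑ P ∈ monicIrreducibles F n,
    if P.natDegree ∣ n then (P.natDegree : C) * polyChar χ ψ P ^ (n / P.natDegree) else 0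

theorem primePowerSum_eq [Finite F] {k n : ℕ} (hk : 1 ≤ k) (hn : k ≤ n) :
    ∑ P ∈ monicIrreducibles F n, ∑ j ∈ Finset.Icc 1 n,
      (if j * P.natDegree = k then (P.natDegree : C) * polyChar χ ψ P ^ j else 0) =
    primePowerSum χ ψ k := by
  symm
  rw [primePowerSum]
  have h1 : ∀ P ∈ monicIrreducibles F n, ∑ j ∈ Finset.Icc 1 n,
      (if j * P.natDegree = k then (P.natDegree : C) * polyChar χ ψ P ^ j else 0) =
      if P.natDegree ∣ k then (P.natDegree : C) * polyChar χ ψ P ^ (k / P.natDegree) else 0 := by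
    intro P hP
    have hpos := (mem_monicIrreducibles.1 hP).2.1.natDegree_pos
    split_ifs with hd
    · obtain ⟨j, rfl⟩ := hd
      rw [Nat.mul_div_cancel_left _ hpos, Finset.sum_eq_single j]
      · rw [if_pos (mul_comm _ _)]
      · intro i _ hi
        rw [if_neg]
        intro h
        rw [mul_comm] at h
        exact hi (Nat.eq_of_mul_eq_mul_left hpos h)
      · intro hj
        exfalso
        refine hj (Finset.mem_Icc.2 ⟨Nat.pos_of_mul_pos_left hk, ?_⟩)
        exact (Nat.le_mul_of_pos_left _ hpos).trans hn
    · refine Finset.sum_eq_zero fun j _ => if_neg ?_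
      rintro rfl
      exact hd (dvd_mul_left _ _)
  rw [Finset.sum_congr rfl h1]
  refine Finset.sum_subset (fun P hP => ?_) fun P hP hP' => if_neg fun hd => hP' ?_
  · obtain ⟨h1, h2, h3⟩ := mem_monicIrreducibles.1 hP
    exact mem_monicIrreducibles.2 ⟨h1, h2, h3.trans hn⟩
  · obtain ⟨h1, h2, h3⟩ := mem_monicIrreducibles.1 hP
    exact mem_monicIrreducibles.2 ⟨h1, h2, Nat.le_of_dvd hk hd⟩

open scoped Classical in
theorem natCast_mul_sum_polyChar [Fintype F] [IsDomain C] (hχ : χ ≠ 1) (n : ℕ) :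
    (n : C) * ∑ f ∈ monics F n, polyChar χ ψ f =
    ∑ P ∈ monicIrreducibles F n, ∑ j ∈ Finset.Icc 1 n,
        ((if j * P.natDegree = n then (P.natDegree : C) * polyChar χ ψ P ^ j else 0) +
        gaussSum χ ψ *
          if j * P.natDegree + 1 = n then (P.natDegree : C) * polyChar χ ψ P ^ j else 0) := by
  have h1 : (n : C) * ∑ f ∈ monics F n, polyChar χ ψ f = ∑ P ∈ monicIrreducibles F n,
      ∑ j ∈ Finset.Icc 1 n, (P.natDegree : C) * ∑ f ∈ monics F n with P ^ j ∣ f,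
        polyChar χ ψ f := by
    rw [Finset.mul_sum]
    calc _ = ∑ f ∈ monics F n, ∑ P ∈ monicIrreducibles F n, ∑ j ∈ Finset.Icc 1 n,
          (if P ^ j ∣ f then (P.natDegree : C) * polyChar χ ψ f else 0) := by
          refine Finset.sum_congr rfl fun f hf => ?_
          conv_lhs => rw [natDegree_eq_sum_prime_powers hf]
          push_cast
          rw [Finset.sum_mul]
          refine Finset.sum_congr rfl fun P _ => ?_
          rw [Finset.sum_mul]
          refine Finset.sum_congr rfl fun j _ => ?_
          rw [ite_mul, zero_mul]
      _ = _ := by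
          rw [Finset.sum_comm]
          refine Finset.sum_congr rfl fun P _ => ?_
          rw [Finset.sum_comm]
          refine Finset.sum_congr rfl fun j _ => ?_
          rw [← Finset.sum_filter, Finset.mul_sum]
  rw [h1]
  refine Finset.sum_congr rfl fun P hP => Finset.sum_congr rfl fun j _ => ?_
  have hm := (mem_monicIrreducibles.1 hP).1
  rw [sum_polyChar_dvd χ ψ (hm.pow j), natDegree_pow, polyChar_pow χ ψ hm]
  by_cases h2 : j * P.natDegree = n
  · rw [if_pos h2.le, if_pos h2, if_neg (by lia), h2, Nat.sub_self, sum_polyChar_zero]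
    ring
  by_cases h3 : j * P.natDegree + 1 = n
  · have h4 : n - j * P.natDegree = 1 := by lia
    rw [if_pos (by lia), if_neg h2, if_pos h3, h4, sum_polyChar_one]
    ring
  rw [if_neg h2, if_neg h3]
  split_ifs with h4
  · obtain ⟨i, hi⟩ : ∃ i, n - j * P.natDegree = i + 2 := ⟨n - j * P.natDegree - 2, by lia⟩
    rw [hi, sum_polyChar_eq_zero χ ψ hχ]
    ring
  · ring

theorem primePowerSum_one [Fintype F] [IsDomain C] (hχ : χ ≠ 1) :
    primePowerSum χ ψ 1 = gaussSum χ ψ := by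
  have h := natCast_mul_sum_polyChar χ ψ hχ 1
  rw [sum_polyChar_one, Nat.cast_one, one_mul] at h
  rw [h, ← primePowerSum_eq χ ψ le_rfl le_rfl]
  refine Finset.sum_congr rfl fun P hP => Finset.sum_congr rfl fun j hj => ?_
  have hpos := (mem_monicIrreducibles.1 hP).2.1.natDegree_pos
  have hj := (Finset.mem_Icc.1 hj).1
  have : j * P.natDegree ≠ 0 := by positivity
  rw [if_neg (c := j * P.natDegree + 1 = 1) (by lia), mul_zero, add_zero]

theorem primePowerSum_succ [Fintype F] [IsDomain C] (hχ : χ ≠ 1) {n : ℕ} (hn : 1 ≤ n) :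
    primePowerSum χ ψ (n + 1) = -gaussSum χ ψ * primePowerSum χ ψ n := by
  obtain ⟨i, rfl⟩ := Nat.exists_eq_add_of_le' hn
  have h := natCast_mul_sum_polyChar χ ψ hχ (i + 2)
  rw [sum_polyChar_eq_zero χ ψ hχ, mul_zero] at h
  simp only [Finset.sum_add_distrib, ← Finset.mul_sum] at h
  rw [primePowerSum_eq χ ψ (by lia) le_rfl] at h
  have h2 : ∀ x, x + 1 = i + 2 ↔ x = i + 1 := by lia
  simp only [h2] at h
  rw [primePowerSum_eq χ ψ (by lia) (by lia)] at h
  linear_combination -h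

theorem primePowerSum_eq_pow [Fintype F] [IsDomain C] (hχ : χ ≠ 1) {n : ℕ} (hn : 1 ≤ n) :
    primePowerSum χ ψ n = (-1) ^ (n + 1) * gaussSum χ ψ ^ n := by
  induction n, hn using Nat.le_induction with
  | base => rw [primePowerSum_one χ ψ hχ]; ring
  | succ n hn ih => rw [primePowerSum_succ χ ψ hχ hn, ih]; ring

/-- The Hasse–Davenport relation: the Gauss sum of the lifts of `χ` and `ψ` to an extension of
degree `n` is `(-1) ^ (n + 1)` times the `n`-th power of the Gauss sum of `χ` and `ψ`. -/
theorem sum_norm_trace_eq_gaussSum_pow [Fintype F] [IsDomain C] (hχ : χ ≠ 1)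
    (K : Type*) [Field K] [Fintype K] [Algebra F K] :
    ∑ x : K, χ (Algebra.norm F x) * ψ (Algebra.trace F K x) =
      (-1) ^ (Module.finrank F K + 1) * gaussSum χ ψ ^ Module.finrank F K := by
  classical
  rw [← primePowerSum_eq_pow χ ψ hχ Module.finrank_pos, primePowerSum]
  have hint : ∀ x : K, IsIntegral F x := fun x => Algebra.IsIntegral.isIntegral x
  rw [← Finset.sum_fiberwise_of_maps_to (t := monicIrreducibles F (Module.finrank F K))
    (g := minpoly F) fun x _ => mem_monicIrreducibles.2
      ⟨minpoly.monic (hint x), minpoly.irreducible (hint x), minpoly.natDegree_le x⟩]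
  refine Finset.sum_congr rfl fun P hP => ?_
  obtain ⟨h1, h2, -⟩ := mem_monicIrreducibles.1 hP
  split_ifs with hd
  · have hcard := ncard_minpoly_eq F K h1 h2 hd
    have hval : ∀ x ∈ Finset.univ.filter (fun x : K => minpoly F x = P),
        χ (Algebra.norm F x) * ψ (Algebra.trace F K x) =
          polyChar χ ψ P ^ (Module.finrank F K / P.natDegree) := by
      intro x hx
      obtain rfl := (Finset.mem_filter.1 hx).2
      rw [norm_eq_minpoly_pow, trace_eq_smul_minpoly, map_pow, AddChar.map_nsmul_eq_pow, polyChar,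
        mul_pow]
    rw [Finset.sum_congr rfl hval, Finset.sum_const, nsmul_eq_mul]
    congr 2
    rw [← hcard, Set.ncard_eq_toFinset_card']
    congr 1
    ext x
    simp
  · refine Finset.sum_eq_zero fun x hx => ?_
    obtain rfl := (Finset.mem_filter.1 hx).2
    exact absurd (Dvd.intro _ (finrank_eq_natDegree_mul_finrank F x).symm) hd

end HasseDavenport

/-! ### Cube roots of unity and the cubic character -/

section Zeta

theorem isPrimitiveRoot_zeta : IsPrimitiveRoot zeta 3 := by
  have := Complex.isPrimitiveRoot_exp 3 (by norm_num)
  simpa [zeta] using this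

theorem zeta_pow_three : zeta ^ 3 = 1 := isPrimitiveRoot_zeta.pow_eq_one

theorem one_add_zeta_add_zeta_sq : 1 + zeta + zeta ^ 2 = 0 := by
  have := isPrimitiveRoot_zeta.geom_sum_eq_zero (by norm_num)
  simpa [Finset.sum_range_succ] using this

theorem zeta_ne_zero : zeta ≠ 0 := isPrimitiveRoot_zeta.ne_zero (by norm_num)

theorem zeta_pow_eq_zeta_pow_iff {i j : ℕ} : zeta ^ i = zeta ^ j ↔ i % 3 = j % 3 := by
  rw [pow_eq_pow_mod i zeta_pow_three, pow_eq_pow_mod j zeta_pow_three]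
  exact ⟨isPrimitiveRoot_zeta.pow_inj (Nat.mod_lt _ (by norm_num)) (Nat.mod_lt _ (by norm_num)),
    fun h => by rw [h]⟩

theorem two_mul_zeta_add_one : 2 * zeta + 1 = Complex.I * (Real.sqrt 3 : ℂ) := by
  have h : (2 * Real.pi * Complex.I / 3 : ℂ) = ((Real.pi - Real.pi / 3 : ℝ) : ℂ) * Complex.I := by
    push_cast; ring
  rw [zeta, h, Complex.exp_mul_I, ← Complex.ofReal_cos, ← Complex.ofReal_sin, Real.cos_pi_sub,
    Real.sin_pi_sub, Real.cos_pi_div_three, Real.sin_pi_div_three]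
  push_cast
  ring

theorem conj_zeta : (starRingEnd ℂ) zeta = zeta ^ 2 := by
  have h : zeta * (starRingEnd ℂ) zeta = 1 := by
    rw [Complex.mul_conj, Complex.normSq_eq_norm_sq,
      isPrimitiveRoot_zeta.norm'_eq_one (by norm_num)]
    norm_num
  apply mul_left_cancel₀ zeta_ne_zero
  rw [h, ← pow_succ', zeta_pow_three]

end Zeta

section Uniqueness

/-- Two representations `p = A ^ 2 + 3 B ^ 2` in which `A + B s` vanishes modulo `p` for the same
`s` with `s ^ 2 = -3`, and `A ≡ -1 [ZMOD 3]`, agree: they generate the same prime above `p`. -/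
theorem eq_of_sq_add_three_mul_sq {p : ℕ} [Fact p.Prime] {A B a b : ℤ}
    (hA : A ^ 2 + 3 * B ^ 2 = p) (ha : a ^ 2 + 3 * b ^ 2 = p) {s : ZMod p}
    (hAs : (A : ZMod p) + B * s = 0) (has : (a : ZMod p) + b * s = 0)
    (hA3 : A ≡ -1 [ZMOD 3]) (ha3 : a ≡ -1 [ZMOD 3]) : A = a ∧ B = b := by
  have hp : (0 : ℤ) < p := by exact_mod_cast (Fact.out : p.Prime).pos
  have hdvd : (p : ℤ) ∣ A * b - a * B := by
    rw [← ZMod.intCast_zmod_eq_zero_iff_dvd]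
    push_cast
    linear_combination (b : ZMod p) * hAs - (B : ZMod p) * has
  obtain ⟨k, hk⟩ := hdvd
  have hid : (A * a + 3 * B * b) ^ 2 + 3 * (A * b - a * B) ^ 2 = (p : ℤ) ^ 2 := by
    rw [sq (p : ℤ)]
    nth_rewrite 1 [← hA]
    rw [← ha]
    ring
  have hk0 : k = 0 := by
    by_contra hk0
    have h1 : 1 ≤ k ^ 2 := by have := sq_pos_of_ne_zero hk0; lia
    rw [hk] at hid
    nlinarith [sq_nonneg (A * a + 3 * B * b), mul_pos hp hp]
  rw [hk0, mul_zero] at hk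
  rw [hk] at hid
  have hsq : (A * a + 3 * B * b) ^ 2 = (p : ℤ) ^ 2 := by linarith
  have hpA : (p : ℤ) * A = a * (A * a + 3 * B * b) := by
    rw [← ha]; linear_combination 3 * b * hk
  have hpB : (p : ℤ) * B = b * (A * a + 3 * B * b) := by
    rw [← ha]; linear_combination -a * hk
  rcases sq_eq_sq_iff_eq_or_eq_neg.1 hsq with h | h
  · rw [h, mul_comm] at hpA hpB
    exact ⟨mul_right_cancel₀ hp.ne' hpA, mul_right_cancel₀ hp.ne' hpB⟩
  · exfalso
    rw [h, mul_comm, mul_neg, ← neg_mul] at hpA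
    have := mul_right_cancel₀ hp.ne' hpA
    rw [Int.ModEq] at hA3 ha3
    lia

end Uniqueness

section CubicChar
variable {p : ℕ} [Fact p.Prime]

theorem sum_eval_eq_zero {f : (ZMod p)[X]} (hf : f.natDegree < p - 1) :
    ∑ x : ZMod p, f.eval x = 0 := by
  simp only [eval_eq_sum_range]
  rw [Finset.sum_comm]
  refine Finset.sum_eq_zero fun i hi => ?_
  rw [← Finset.mul_sum, FiniteField.sum_pow_lt_card_sub_one, mul_zero]
  rw [ZMod.card]
  have := Finset.mem_range.1 hi
  lia

variable {g : (ZMod p)ˣ} (hg : ∀ x : (ZMod p)ˣ, x ∈ Subgroup.zpowers g)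
  {χ : MulChar (ZMod p) ℂ} (hχ : χ (g : ZMod p) = zeta)

include hg in
theorem exists_pow_eq_of_ne_zero {x : ZMod p} (hx : x ≠ 0) : ∃ k : ℕ, (g : ZMod p) ^ k = x := by
  obtain ⟨k, hk⟩ := (mem_powers_iff_mem_zpowers (y := Units.mk0 x hx)).2 (hg _)
  exact ⟨k, by simpa using congrArg Units.val hk⟩

include hg hχ in
theorem cubic_pow_three : χ ^ 3 = 1 := by
  ext x
  obtain ⟨k, hk⟩ := exists_pow_eq_of_ne_zero hg x.ne_zero
  rw [MulChar.pow_apply_coe, MulChar.one_apply_coe, ← hk, map_pow, hχ, ← pow_mul, mul_comm, pow_mul,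
    zeta_pow_three, one_pow]

include hχ in
theorem cubic_ne_one : χ ≠ 1 := by
  rintro rfl
  rw [MulChar.one_apply_coe] at hχ
  exact isPrimitiveRoot_zeta.ne_one (by norm_num) hχ.symm

include hg hχ in
theorem orderOf_cubic : orderOf χ = 3 :=
  orderOf_eq_prime (cubic_pow_three hg hχ) (cubic_ne_one hχ)

include hg hχ in
theorem cubic_inv : χ⁻¹ = χ ^ 2 := by
  rw [inv_eq_iff_mul_eq_one, ← pow_succ', cubic_pow_three hg hχ]

include hg hχ in
theorem cubic_sq_ne_one : χ ^ 2 ≠ 1 := by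
  rw [← cubic_inv hg hχ, Ne, inv_eq_one]
  exact cubic_ne_one hχ

include hg hχ in
theorem cubic_apply_pow_three {x : ZMod p} (hx : x ≠ 0) : χ x ^ 3 = 1 := by
  rw [← MulChar.pow_apply' _ (by norm_num), cubic_pow_three hg hχ, MulChar.one_apply hx.isUnit]

include hg hχ in
theorem conj_cubic (x : ZMod p) : (starRingEnd ℂ) (χ x) = χ x ^ 2 := by
  rw [← MulChar.pow_apply' _ (by norm_num), ← cubic_inv hg hχ]
  exact MulChar.star_apply' χ x

end CubicChar

/-! ### The cubic Jacobi sum -/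

section CubicJacobi
variable {p : ℕ} [Fact p.Prime]

/-- The quadratic character of `ℤ/p` with values in `ℂ`. -/
def etaChar (p : ℕ) [Fact p.Prime] : MulChar (ZMod p) ℂ :=
  (quadraticChar (ZMod p)).ringHomComp (Int.castRingHom ℂ)

theorem etaChar_apply (x : ZMod p) : etaChar p x = (quadraticChar (ZMod p) x : ℂ) := rfl

theorem etaChar_ne_one (hp2 : p ≠ 2) : etaChar p ≠ 1 := by
  rw [etaChar, MulChar.ringHomComp_ne_one_iff]
  · exact quadraticChar_ne_one (by rwa [ZMod.ringChar_zmod_n])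
  · exact Int.cast_injective

theorem etaChar_sq : etaChar p ^ 2 = 1 :=
  ((quadraticChar_isQuadratic (ZMod p)).comp _).sq_eq_one

/-- Substituting `x ↦ (1 + y) / 2` in `J(χ, χ)` and counting the square roots of `y ^ 2` by
`1 + η`. -/
theorem jacobiSum_self_eq (hp2 : p ≠ 2) {χ : MulChar (ZMod p) ℂ} (hχ : χ ≠ 1) :
    χ 4 * jacobiSum χ χ = jacobiSum χ (etaChar p) := by
  have h2 : (2 : ZMod p) ≠ 0 := Ring.two_ne_zero (by rwa [ZMod.ringChar_zmod_n])
  have h1 : χ 4 * jacobiSum χ χ = ∑ y : ZMod p, χ (1 - y ^ 2) := by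
    rw [jacobiSum, Finset.mul_sum]
    refine Fintype.sum_equiv ((Equiv.mulLeft₀ 2 h2).trans (Equiv.subRight 1)) _ _ fun x => ?_
    rw [← map_mul, ← map_mul]
    congr 1
    simp only [Equiv.trans_apply, Equiv.mulLeft₀_apply, Equiv.subRight_apply]
    ring
  have h3 : ∑ y : ZMod p, χ (1 - y ^ 2) =
      ∑ u : ZMod p, ((quadraticChar (ZMod p) u + 1 : ℤ) : ℂ) * χ (1 - u) := by
    rw [← Finset.sum_fiberwise_of_maps_to (t := Finset.univ) (g := fun y : ZMod p => y ^ 2)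
      fun _ _ => Finset.mem_univ _]
    refine Finset.sum_congr rfl fun u _ => ?_
    rw [Finset.sum_congr rfl fun y hy => by rw [(Finset.mem_filter.1 hy).2], Finset.sum_const,
      nsmul_eq_mul, ← quadraticChar_card_sqrts (by rwa [ZMod.ringChar_zmod_n]), Int.cast_natCast]
    congr 3
    ext y
    simp
  have h4 : ∑ u : ZMod p, χ (1 - u) = 0 := by
    rw [← MulChar.sum_eq_zero_of_ne_one hχ]
    exact (Equiv.subLeft (1 : ZMod p)).sum_comp χ
  rw [h1, h3, jacobiSum_comm, jacobiSum]
  simp only [Int.cast_add, add_mul, Finset.sum_add_distrib, Int.cast_one, one_mul, h4, add_zero,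
    etaChar_apply]

variable {g : (ZMod p)ˣ} (hg : ∀ x : (ZMod p)ˣ, x ∈ Subgroup.zpowers g)
  {χ : MulChar (ZMod p) ℂ} (hχ : χ (g : ZMod p) = zeta)

/-- The cubic residue class `χ = ζ ^ j`. -/
def cubicClass (χ : MulChar (ZMod p) ℂ) (j : ℕ) : Finset (ZMod p) :=
  Finset.univ.filter fun v => χ v = zeta ^ j

include hg hχ in
theorem cubic_mem_range {v : ZMod p} (hv : v ≠ 0) : χ v = 1 ∨ χ v = zeta ∨ χ v = zeta ^ 2 := by
  obtain ⟨i, hi, h⟩ := isPrimitiveRoot_zeta.eq_pow_of_pow_eq_one (cubic_apply_pow_three hg hχ hv)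
  interval_cases i
  · left; rw [← h, pow_zero]
  · right; left; rw [← h, pow_one]
  · right; right; exact h.symm

include hg hχ in
theorem sum_eq_sum_cubicClass {M : Type*} [AddCommMonoid M] {φ : ZMod p → M} (h0 : φ 0 = 0) :
    ∑ v, φ v = ∑ v ∈ cubicClass χ 0, φ v + ∑ v ∈ cubicClass χ 1, φ v +
      ∑ v ∈ cubicClass χ 2, φ v := by
  simp only [cubicClass, Finset.sum_filter, ← Finset.sum_add_distrib]
  refine Finset.sum_congr rfl fun v _ => ?_
  have h01 : zeta ≠ 1 := isPrimitiveRoot_zeta.ne_one (by norm_num)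
  have h02 : zeta ^ 2 ≠ 1 :=
    isPrimitiveRoot_zeta.pow_ne_one_of_pos_of_lt (by norm_num) (by norm_num)
  have h12 : zeta ^ 2 ≠ zeta := fun h =>
    absurd ((zeta_pow_eq_zeta_pow_iff (i := 2) (j := 1)).1 (by rwa [pow_one])) (by norm_num)
  by_cases hv : v = 0
  · subst hv
    simp [h0]
  · rcases cubic_mem_range hg hχ hv with h | h | h <;>
      simp [h, h01, h02, h12, h01.symm, h02.symm, h12.symm]

theorem zero_notMem_cubicClass (j : ℕ) : (0 : ZMod p) ∉ cubicClass χ j := by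
  simp only [cubicClass, Finset.mem_filter, Finset.mem_univ, true_and, MulChar.map_zero]
  exact (pow_ne_zero j zeta_ne_zero).symm

include hg hχ in
theorem card_cubicClass_one_eq_two : (cubicClass χ 1).card = (cubicClass χ 2).card := by
  refine Finset.card_bij' (fun v _ => v⁻¹) (fun v _ => v⁻¹) ?_ ?_ (by simp) (by simp)
  · intro v hv
    rw [cubicClass, Finset.mem_filter, pow_one] at hv
    rw [cubicClass, Finset.mem_filter, ← MulChar.inv_apply', cubic_inv hg hχ,
      MulChar.pow_apply' _ (by norm_num), hv.2]
    exact ⟨Finset.mem_univ _, rfl⟩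
  · intro v hv
    rw [cubicClass, Finset.mem_filter] at hv
    rw [cubicClass, Finset.mem_filter, ← MulChar.inv_apply', cubic_inv hg hχ,
      MulChar.pow_apply' _ (by norm_num), hv.2]
    refine ⟨Finset.mem_univ _, ?_⟩
    rw [← pow_mul, show 2 * 2 = 3 + 1 from rfl, pow_add, zeta_pow_three, one_mul]

/-- The sum of the quadratic character of `1 - v` over the cubic residue class `χ v = ζ ^ j`; these
integers are the coefficients of `J(χ, η)` on the powers of `ζ`. -/
def classSum (χ : MulChar (ZMod p) ℂ) (j : ℕ) : ℤ :=
  ∑ v ∈ cubicClass χ j, quadraticChar (ZMod p) (1 - v)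

include hg hχ in
theorem jacobiSum_eta_eq : jacobiSum χ (etaChar p) =
    classSum χ 0 + classSum χ 1 * zeta + classSum χ 2 * zeta ^ 2 := by
  rw [jacobiSum, sum_eq_sum_cubicClass hg hχ (by simp [χ.map_zero])]
  have key : ∀ j, ∑ v ∈ cubicClass χ j, χ v * etaChar p (1 - v) = classSum χ j * zeta ^ j := by
    intro j
    rw [classSum, Int.cast_sum, Finset.sum_mul]
    refine Finset.sum_congr rfl fun v hv => ?_
    rw [(Finset.mem_filter.1 hv).2, etaChar_apply, mul_comm]
  rw [key, key, key, pow_zero, pow_one, mul_one]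

include hg hχ in
theorem sum_classSum (hp2 : p ≠ 2) : classSum χ 0 + classSum χ 1 + classSum χ 2 = -1 := by
  have h1 : ∑ v : ZMod p, quadraticChar (ZMod p) (1 - v) = 0 := by
    rw [← quadraticChar_sum_zero (F := ZMod p) (by rwa [ZMod.ringChar_zmod_n])]
    exact (Equiv.subLeft (1 : ZMod p)).sum_comp (quadraticChar (ZMod p))
  have h2 := sum_eq_sum_cubicClass hg hχ
    (φ := fun v : ZMod p => if v = 0 then 0 else quadraticChar (ZMod p) (1 - v)) (by simp)
  have h3 : ∀ j, ∑ v ∈ cubicClass χ j,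
      (if v = 0 then 0 else quadraticChar (ZMod p) (1 - v)) = classSum χ j := fun j =>
    Finset.sum_congr rfl fun v hv => if_neg fun h => zero_notMem_cubicClass j (h ▸ hv)
  rw [h3, h3, h3] at h2
  rw [← h2, Finset.sum_ite, Finset.sum_const_zero, zero_add]
  have h4 : (Finset.univ.filter fun v : ZMod p => ¬ v = 0) = Finset.univ.erase 0 := by
    ext v; simp
  rw [h4, Finset.sum_erase_eq_sub (Finset.mem_univ _), h1]
  simp

/-- Off the class `χ v = 1` every `1 - v` is nonzero, so that its quadratic character is odd. -/
theorem classSum_emod_two {j : ℕ} (hj : j % 3 ≠ 0) :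
    classSum χ j ≡ (cubicClass χ j).card [ZMOD 2] := by
  refine (ZMod.intCast_eq_intCast_iff _ _ 2).1 ?_
  rw [classSum]
  push_cast
  rw [Finset.cast_card]
  refine Finset.sum_congr rfl fun v hv => ?_
  have hv1 : 1 - v ≠ 0 := by
    intro h
    obtain rfl := sub_eq_zero.1 h
    have := (Finset.mem_filter.1 hv).2
    rw [map_one, eq_comm, isPrimitiveRoot_zeta.pow_eq_one_iff_dvd] at this
    lia
  rcases quadraticChar_dichotomy hv1 with h | h <;> rw [h] <;> decide

include hg hχ in
theorem classSum_one_emod_two : classSum χ 1 ≡ classSum χ 2 [ZMOD 2] := by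
  refine (classSum_emod_two (by norm_num)).trans ?_
  rw [card_cubicClass_one_eq_two hg hχ]
  exact (classSum_emod_two (by norm_num)).symm

section Mod
variable (hp : p ≡ 1 [MOD 3])

include hp in
theorem seven_le_of_mod_three : 7 ≤ p := by
  have h2 := (Fact.out : p.Prime).two_le
  have h4 : p ≠ 4 := by rintro rfl; exact absurd (Fact.out : Nat.Prime 4) (by norm_num)
  rw [Nat.ModEq] at hp
  lia

include hp in
theorem three_mul_div : 3 * ((p - 1) / 3) = p - 1 := by
  have := (Fact.out : p.Prime).two_le
  rw [Nat.ModEq] at hp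
  lia

include hg hp in
theorem one_add_root_add_root_sq :
    1 + (g : ZMod p) ^ ((p - 1) / 3) + ((g : ZMod p) ^ ((p - 1) / 3)) ^ 2 = 0 := by
  set w := (g : ZMod p) ^ ((p - 1) / 3) with hw
  have h7 := seven_le_of_mod_three hp
  have h3 : w ^ 3 = 1 := by
    rw [hw, ← pow_mul, mul_comm, three_mul_div hp]
    exact ZMod.pow_card_sub_one_eq_one g.ne_zero
  have hord : orderOf g = p - 1 := by
    rw [orderOf_eq_card_of_forall_mem_zpowers hg, Nat.card_eq_fintype_card, ZMod.card_units]
  have h1 : w ≠ 1 := by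
    intro h
    have h' : g ^ ((p - 1) / 3) = 1 :=
      Units.ext (by rw [Units.val_pow_eq_pow_val, Units.val_one, ← h])
    have := Nat.le_of_dvd (by lia) (orderOf_dvd_of_pow_eq_one h')
    lia
  have : (w - 1) * (1 + w + w ^ 2) = 0 := by linear_combination h3
  exact (mul_eq_zero.1 this).resolve_left (sub_ne_zero.2 h1)

include hg hχ hp in
/-- On the class `χ v = ζ ^ j` the power `v ^ ((p - 1) / 3)` is the `j`-th power of the cube root of
unity `g ^ ((p - 1) / 3)` modulo `p`. -/
theorem pow_eq_of_mem_cubicClass {v : ZMod p} {j : ℕ} (hv : v ∈ cubicClass χ j) :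
    v ^ ((p - 1) / 3) = ((g : ZMod p) ^ ((p - 1) / 3)) ^ j := by
  have hv0 : v ≠ 0 := fun h => zero_notMem_cubicClass j (h ▸ hv)
  obtain ⟨k, rfl⟩ := exists_pow_eq_of_ne_zero hg hv0
  have hk := (Finset.mem_filter.1 hv).2
  have h3 : ((g : ZMod p) ^ ((p - 1) / 3)) ^ 3 = 1 := by
    rw [← pow_mul, mul_comm, three_mul_div hp]
    exact ZMod.pow_card_sub_one_eq_one g.ne_zero
  rw [map_pow, hχ, zeta_pow_eq_zeta_pow_iff] at hk
  rw [← pow_mul, mul_comm, pow_mul, ← Nat.mod_add_div k 3, ← Nat.mod_add_div j 3, hk, pow_add,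
    pow_add, pow_mul, pow_mul _ 3 (j / 3), h3, one_pow, one_pow]

include hg hχ hp in
/-- Reducing `J(χ, η)` modulo a prime above `p` gives `∑ v ^ ((p - 1) / 3) (1 - v) ^ ((p - 1) / 2)`,
a sum of values of a polynomial of degree less than `p - 1`, which vanishes. -/
theorem classSum_mod_p : (classSum χ 0 : ZMod p) + classSum χ 1 * (g : ZMod p) ^ ((p - 1) / 3) +
    classSum χ 2 * ((g : ZMod p) ^ ((p - 1) / 3)) ^ 2 = 0 := by
  have h7 := seven_le_of_mod_three hp
  have hdeg : ((X : (ZMod p)[X]) ^ ((p - 1) / 3) * (1 - X) ^ (p / 2)).natDegree < p - 1 := by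
    have h1 : (1 - X : (ZMod p)[X]).natDegree ≤ 1 := by
      refine (natDegree_sub_le _ _).trans ?_
      simp
    have h2 := natDegree_mul_le (p := (X : (ZMod p)[X]) ^ ((p - 1) / 3)) (q := (1 - X) ^ (p / 2))
    have h3 := natDegree_pow_le (p := (1 - X : (ZMod p)[X])) (n := p / 2)
    rw [natDegree_X_pow] at h2
    have h4 : p / 2 * (1 - X : (ZMod p)[X]).natDegree ≤ p / 2 * 1 := Nat.mul_le_mul_left _ h1
    lia
  have h := sum_eval_eq_zero hdeg
  simp only [eval_mul, eval_pow, eval_X, eval_sub, eval_one] at h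
  rw [sum_eq_sum_cubicClass hg hχ (by rw [zero_pow (by lia), zero_mul])] at h
  have key : ∀ j, ∑ v ∈ cubicClass χ j, v ^ ((p - 1) / 3) * (1 - v) ^ (p / 2) =
      classSum χ j * ((g : ZMod p) ^ ((p - 1) / 3)) ^ j := by
    intro j
    rw [classSum, Int.cast_sum, Finset.sum_mul]
    refine Finset.sum_congr rfl fun v hv => ?_
    rw [pow_eq_of_mem_cubicClass hg hχ hp hv, quadraticChar_eq_pow_of_char_ne_two'
      (by rw [ZMod.ringChar_zmod_n]; lia), ZMod.card, mul_comm]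
  rw [key, key, key, pow_zero, pow_one, mul_one] at h
  exact h

include hg hχ hp in
theorem jacobiSum_eta_mul_conj :
    jacobiSum χ (etaChar p) * (starRingEnd ℂ) (jacobiSum χ (etaChar p)) = p := by
  have h7 := seven_le_of_mod_three hp
  have hconj : ∀ φ : MulChar (ZMod p) ℂ, φ.ringHomComp (starRingEnd ℂ) = φ⁻¹ :=
    fun φ => MulChar.star_eq_inv φ
  rw [← jacobiSum_ringHomComp, hconj, hconj, jacobiSum_mul_jacobiSum_inv, ZMod.card]
  · rw [ZMod.ringChar_zmod_n, ringChar.eq_zero]; lia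
  · exact cubic_ne_one hχ
  · exact etaChar_ne_one (by lia)
  · intro h
    apply cubic_sq_ne_one hg hχ
    have h2 : (χ * etaChar p) ^ 2 = 1 := by rw [h, one_pow]
    rwa [mul_pow, etaChar_sq, mul_one] at h2

include hg hχ hp in
/-- The cubic Jacobi sum is determined by its norm `p`, its divisibility by one of the two primes
above `p`, and its class modulo `3`. -/
theorem jacobiSum_eq_piThree {a₃ b₃ : ℤ} (hab : a₃ ^ 2 + 3 * b₃ ^ 2 = (p : ℤ))
    (ha₃ : a₃ ≡ -1 [ZMOD 3])
    (hb₃ : 3 * (b₃ : ZMod p) = (2 * (g : ZMod p) ^ ((p - 1) / 3) + 1) * (a₃ : ZMod p)) :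
    jacobiSum χ χ = piThree χ a₃ b₃ := by
  have h7 := seven_le_of_mod_three hp
  set w := (g : ZMod p) ^ ((p - 1) / 3) with hw
  have hw2 : 1 + w + w ^ 2 = 0 := one_add_root_add_root_sq hg hp
  obtain ⟨B, hB⟩ := (classSum_one_emod_two hg hχ).symm.dvd
  have hsum := sum_classSum hg hχ (by lia)
  -- As `ζ ^ 2 = -1 - ζ` and `2 ζ + 1 = √-3`, this is the rational part of `J(χ, η)`.
  set A : ℤ := classSum χ 0 - classSum χ 2 - B with hA
  have hK : jacobiSum χ (etaChar p) = A + B * (2 * zeta + 1) := by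
    have h1 : (classSum χ 1 : ℂ) = classSum χ 2 + 2 * B := by
      rw [sub_eq_iff_eq_add] at hB
      rw [hB]; push_cast; ring
    rw [jacobiSum_eta_eq hg hχ, hA, h1]
    push_cast
    linear_combination (classSum χ 2 : ℂ) * one_add_zeta_add_zeta_sq
  have hnorm : A ^ 2 + 3 * B ^ 2 = p := by
    have h1 := jacobiSum_eta_mul_conj hg hχ hp
    rw [hK] at h1
    simp only [map_add, map_mul, map_one, map_intCast, map_ofNat, conj_zeta] at h1
    have h2 : (A : ℂ) ^ 2 + 3 * B ^ 2 = p := by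
      rw [← h1]
      linear_combination (-4 * (B : ℂ) ^ 2) * zeta_pow_three +
        (-2 * (A : ℂ) * B - 2 * B ^ 2) * one_add_zeta_add_zeta_sq
    exact_mod_cast h2
  have hAw : (A : ZMod p) + B * (2 * w + 1) = 0 := by
    have h1 := classSum_mod_p hg hχ hp
    rw [← hw] at h1
    have h2 : (classSum χ 1 : ZMod p) = classSum χ 2 + 2 * B := by
      rw [sub_eq_iff_eq_add] at hB
      rw [hB]; push_cast; ring
    rw [h2] at h1
    rw [hA]
    push_cast
    linear_combination h1 - (classSum χ 2 : ZMod p) * hw2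
  have h3 : (3 : ZMod p) ≠ 0 := by
    have : ((3 : ℕ) : ZMod p) ≠ 0 := by
      rw [Ne, ZMod.natCast_eq_zero_iff]
      exact fun h => absurd (Nat.le_of_dvd (by norm_num) h) (by lia)
    exact_mod_cast this
  -- With `s = 2 w + 1`, `s ^ 2 = -3`, multiply the hypothesis `3 b₃ = s a₃` by `s`.
  have haw : (a₃ : ZMod p) + b₃ * (2 * w + 1) = 0 := by
    apply (mul_eq_zero.1 (_ : 3 * ((a₃ : ZMod p) + b₃ * (2 * w + 1)) = 0)).resolve_left h3
    linear_combination (2 * w + 1) * hb₃ + 4 * (a₃ : ZMod p) * hw2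
  have hA3 : A ≡ -1 [ZMOD 3] := by
    rw [Int.ModEq]
    lia
  obtain ⟨rfl, rfl⟩ := eq_of_sq_add_three_mul_sq hnorm hab hAw haw hA3 ha₃
  have h2 : (2 : ZMod p) ≠ 0 := Ring.two_ne_zero (by rw [ZMod.ringChar_zmod_n]; lia)
  have h4 := jacobiSum_self_eq (p := p) (by lia) (cubic_ne_one hχ)
  have h5 : χ 4 * χ 2 = 1 := by
    rw [← map_mul, show (4 * 2 : ZMod p) = 2 ^ 3 by norm_num, map_pow,
      cubic_apply_pow_three hg hχ h2]
  rw [piThree]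
  calc jacobiSum χ χ = χ 2 * (χ 4 * jacobiSum χ χ) := by linear_combination -jacobiSum χ χ * h5
    _ = _ := by rw [h4, hK, two_mul_zeta_add_one]; ring

end Mod

end CubicJacobi

/-! ### Counting elements by trace and norm -/

section Counting
variable {p : ℕ} [Fact p.Prime] {g : (ZMod p)ˣ} (hg : ∀ x : (ZMod p)ˣ, x ∈ Subgroup.zpowers g)
  {χ : MulChar (ZMod p) ℂ} (hχ : χ (g : ZMod p) = zeta)

theorem re_zeta_pow {n : ℕ} : (zeta ^ n).re = if n % 3 = 0 then 1 else -1 / 2 := by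
  have h1 : zeta.re = -1 / 2 := by
    have h := congrArg Complex.re two_mul_zeta_add_one
    simp at h
    linarith
  rw [pow_eq_pow_mod n zeta_pow_three]
  have h3 := Nat.mod_lt n (show 3 > 0 by norm_num)
  generalize n % 3 = r at h3 ⊢
  interval_cases r
  · simp
  · simp [h1]
  · rw [← conj_zeta, Complex.conj_re, h1]; simp

include hg hχ in
/-- Orthogonality of the powers of `χ`, the two nontrivial ones being complex conjugate. -/
theorem three_mul_indicator (v : ZMod p) (i : ℕ) :
    3 * (if χ v = zeta ^ i then 1 else 0 : ℝ) =
      (if v = 0 then 0 else 1) + 2 * (zeta ^ (2 * i) * χ v).re := by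
  by_cases hv : v = 0
  · subst hv
    rw [χ.map_zero, if_neg (pow_ne_zero i zeta_ne_zero).symm, if_pos rfl]
    simp
  · obtain ⟨j, -, h⟩ := isPrimitiveRoot_zeta.eq_pow_of_pow_eq_one (cubic_apply_pow_three hg hχ hv)
    rw [← h, ← pow_add, re_zeta_pow, if_neg hv]
    simp only [zeta_pow_eq_zeta_pow_iff]
    by_cases hij : j % 3 = i % 3
    · rw [if_pos hij, if_pos (by lia)]; norm_num
    · rw [if_neg hij, if_neg (by lia)]; norm_num

/-- The sum of `χ` of the norm over the elements of trace `c`. -/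
def traceSum (χ : MulChar (ZMod p) ℂ) (K : Type*) [Field K] [Fintype K] [Algebra (ZMod p) K]
    (c : ZMod p) : ℂ :=
  ∑ x : K, if Algebra.trace (ZMod p) K x = c then χ (Algebra.norm (ZMod p) x) else 0

section Field
variable (K : Type*) [Field K] [Fintype K] [Algebra (ZMod p) K]

theorem ncard_trace_eq (c : ZMod p) :
    {x : K | Algebra.trace (ZMod p) K x = c}.ncard = p ^ (Module.finrank (ZMod p) K - 1) := by
  classical
  let f : K →+ ZMod p := (Algebra.trace (ZMod p) K).toAddMonoidHom
  have hf : Function.Surjective f := Algebra.trace_surjective (ZMod p) K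
  have hN : ∀ c, {x : K | Algebra.trace (ZMod p) K x = c}.ncard =
      (Finset.univ.filter fun x : K => f x = c).card := fun c => by
    rw [Set.ncard_eq_toFinset_card', Set.toFinset_ofPred]
    rfl
  have h1 : ∀ c', (Finset.univ.filter fun x : K => f x = c').card =
      (Finset.univ.filter fun x : K => f x = c).card := fun c' =>
    AddMonoidHom.card_fiber_eq_of_mem_range f (hf c') (hf c)
  have h2 := Finset.card_eq_sum_card_fiberwise (s := (Finset.univ : Finset K))
    (t := (Finset.univ : Finset (ZMod p))) (f := f) fun _ _ => Finset.mem_coe.2 (Finset.mem_univ _)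
  rw [Finset.sum_congr rfl fun c' _ => h1 c', Finset.sum_const, Finset.card_univ, Finset.card_univ,
    ZMod.card, ← FiniteField.pow_finrank_eq_card p K, smul_eq_mul] at h2
  rw [hN]
  have hpos : 0 < Module.finrank (ZMod p) K := Module.finrank_pos
  rw [← Nat.sub_add_cancel hpos, pow_succ'] at h2
  exact (Nat.eq_of_mul_eq_mul_left (Fact.out : p.Prime).pos h2).symm

theorem ncard_trace_eq_ne_zero (c : ZMod p) :
    ({x : K | Algebra.trace (ZMod p) K x = c ∧ x ≠ 0}.ncard : ℝ) =
      (p : ℝ) ^ (Module.finrank (ZMod p) K - 1) - if c = 0 then 1 else 0 := by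
  have h1 := ncard_trace_eq K c
  have h2 : {x : K | Algebra.trace (ZMod p) K x = c ∧ x ≠ 0} =
      {x : K | Algebra.trace (ZMod p) K x = c} \ {0} := by
    ext x; simp
  rw [h2]
  split_ifs with hc
  · have h0 : (0 : K) ∈ {x : K | Algebra.trace (ZMod p) K x = c} := by simp [hc]
    have h3 := Set.ncard_sdiff_singleton_add_one h0 (Set.toFinite _)
    rw [h1] at h3
    rw [← Nat.cast_pow, ← h3]
    push_cast
    ring
  · rw [Set.sdiff_singleton_eq_self (by simpa using Ne.symm hc), h1]
    simp

include hg hχ in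
theorem three_mul_ncard_trace_norm (c : ZMod p) (i : ℕ) :
    3 * ({x : K | Algebra.trace (ZMod p) K x = c ∧
        χ (Algebra.norm (ZMod p) x) = zeta ^ i}.ncard : ℝ) =
      (p : ℝ) ^ (Module.finrank (ZMod p) K - 1) - (if c = 0 then 1 else 0) +
        2 * (zeta ^ (2 * i) * traceSum χ K c).re := by
  classical
  rw [← ncard_trace_eq_ne_zero K c, Set.ncard_eq_toFinset_card', Set.ncard_eq_toFinset_card',
    Set.toFinset_ofPred, Set.toFinset_ofPred, Finset.card_filter, Finset.card_filter, traceSum,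
    Finset.mul_sum, Complex.re_sum, Finset.mul_sum]
  push_cast
  rw [Finset.mul_sum, ← Finset.sum_add_distrib]
  refine Finset.sum_congr rfl fun x _ => ?_
  have h := three_mul_indicator hg hχ (Algebra.norm (ZMod p) x) i
  simp only [Algebra.norm_eq_zero_iff] at h
  by_cases hx : Algebra.trace (ZMod p) K x = c
  · simp only [hx, true_and, if_true]
    rw [h]
    simp
  · simp [hx]

theorem gaussSum_mulShift_eq_inv_mul {φ : MulChar (ZMod p) ℂ} (hφ : φ ≠ 1)
    (ψ : AddChar (ZMod p) ℂ) (y : ZMod p) :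
    gaussSum φ (ψ.mulShift y) = φ⁻¹ y * gaussSum φ ψ := by
  by_cases hy : y = 0
  · subst hy
    rw [AddChar.mulShift_zero, gaussSum_one_right hφ, MulChar.map_zero, zero_mul]
  · exact gaussSum_mulShift_eq φ ψ (Units.mk0 y hy)

/-- Fourier inversion in the trace, followed by the Hasse–Davenport relation for each frequency. -/
theorem natCast_mul_traceSum (hχ1 : χ ≠ 1) (c : ZMod p) :
    (p : ℂ) * traceSum χ K c = (-1) ^ (Module.finrank (ZMod p) K + 1) *
      gaussSum χ ZMod.stdAddChar ^ Module.finrank (ZMod p) K *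
        ∑ y : ZMod p, ZMod.stdAddChar (-c * y) * χ⁻¹ y ^ Module.finrank (ZMod p) K := by
  set ψ : AddChar (ZMod p) ℂ := ZMod.stdAddChar with hψ
  have hprim : ψ.IsPrimitive := ZMod.isPrimitive_stdAddChar p
  have h1 : ∀ x : K, (p : ℂ) * (if Algebra.trace (ZMod p) K x = c then
      χ (Algebra.norm (ZMod p) x) else 0) = ∑ y : ZMod p, ψ (-c * y) *
        (χ (Algebra.norm (ZMod p) x) * ψ.mulShift y (Algebra.trace (ZMod p) K x)) := by
    intro x
    have h2 := AddChar.sum_mulShift (Algebra.trace (ZMod p) K x - c) hprim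
    rw [ZMod.card] at h2
    have h3 : ∀ y : ZMod p, ψ (-c * y) * (χ (Algebra.norm (ZMod p) x) *
        ψ.mulShift y (Algebra.trace (ZMod p) K x)) =
        χ (Algebra.norm (ZMod p) x) * ψ (y * (Algebra.trace (ZMod p) K x - c)) := by
      intro y
      rw [AddChar.mulShift_apply, mul_left_comm, ← AddChar.map_add_eq_mul]
      congr 2
      ring
    simp only [h3]
    rw [← Finset.mul_sum, h2]
    simp only [sub_eq_zero]
    split_ifs <;> simp [mul_comm]
  rw [traceSum, Finset.mul_sum, Finset.sum_congr rfl fun x _ => h1 x, Finset.sum_comm,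
    Finset.mul_sum]
  refine Finset.sum_congr rfl fun y _ => ?_
  rw [← Finset.mul_sum, sum_norm_trace_eq_gaussSum_pow χ (ψ.mulShift y) hχ1 K,
    gaussSum_mulShift_eq_inv_mul hχ1, mul_pow]
  ring

include hg hχ in
theorem cubic_neg_one : χ (-1) = 1 := by
  have h := cubic_apply_pow_three hg hχ (x := -1) (by simp)
  rw [← map_pow] at h
  rw [← h]
  congr 1
  ring

include hg hχ in
theorem cubic_neg (x : ZMod p) : χ (-x) = χ x := by
  rw [neg_eq_neg_one_mul, map_mul, cubic_neg_one hg hχ, one_mul]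

include hg hχ in
theorem gaussSum_cubic_pow_three :
    gaussSum χ ZMod.stdAddChar ^ 3 = p * jacobiSum χ χ := by
  have h := gaussSum_pow_eq_prod_jacobiSum (χ := χ) (by rw [orderOf_cubic hg hχ]; norm_num)
    (ZMod.isPrimitive_stdAddChar p)
  rw [orderOf_cubic hg hχ, cubic_neg_one hg hχ, ZMod.card] at h
  simpa using h

include hg hχ in
theorem gaussSum_cubic_mul_inv :
    gaussSum χ ZMod.stdAddChar * gaussSum χ⁻¹ ZMod.stdAddChar = p := by
  have h := gaussSum_mul_gaussSum_pow_orderOf_sub_one (cubic_ne_one hχ)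
    (ZMod.isPrimitive_stdAddChar p)
  rw [orderOf_cubic hg hχ, cubic_neg_one hg hχ, ZMod.card, one_mul] at h
  rw [cubic_inv hg hχ]
  exact h

theorem natCast_ne_zero_complex : (p : ℂ) ≠ 0 := Nat.cast_ne_zero.2 (Fact.out : p.Prime).ne_zero

include hg hχ in
theorem cubic_inv_apply_pow_three {y : ZMod p} (hy : y ≠ 0) : χ⁻¹ y ^ 3 = 1 := by
  rw [MulChar.inv_apply', cubic_apply_pow_three hg hχ (inv_ne_zero hy)]

include hg hχ in
theorem traceSum_of_mod_zero {k : ℕ} (ht : Module.finrank (ZMod p) K = 3 * (k + 1)) (c : ZMod p) :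
    traceSum χ K c = (-1) ^ (Module.finrank (ZMod p) K + 1) * (p : ℂ) ^ k *
      jacobiSum χ χ ^ (k + 1) * ((if c = 0 then (p : ℂ) else 0) - 1) := by
  have hT : ∑ y : ZMod p, ZMod.stdAddChar (-c * y) * χ⁻¹ y ^ Module.finrank (ZMod p) K =
      (if c = 0 then (p : ℂ) else 0) - 1 := by
    have h1 : ∀ y : ZMod p, (ZMod.stdAddChar (-c * y) : ℂ) * χ⁻¹ y ^ Module.finrank (ZMod p) K =
        ZMod.stdAddChar (y * -c) - if y = 0 then 1 else 0 := by
      intro y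
      by_cases hy : y = 0
      · subst hy
        rw [MulChar.map_zero, zero_pow (by lia)]
        simp
      · rw [ht, pow_mul, cubic_inv_apply_pow_three hg hχ hy, one_pow, if_neg hy, mul_one, sub_zero,
          mul_comm]
    rw [Finset.sum_congr rfl fun y _ => h1 y, Finset.sum_sub_distrib,
      AddChar.sum_mulShift _ (ZMod.isPrimitive_stdAddChar p), ZMod.card]
    simp
  have h := natCast_mul_traceSum K (cubic_ne_one hχ) c
  rw [hT] at h
  apply mul_left_cancel₀ (natCast_ne_zero_complex (p := p))
  rw [h]
  nth_rewrite 2 [ht]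
  rw [pow_mul (gaussSum _ _), gaussSum_cubic_pow_three hg hχ]
  ring

include hg hχ in
theorem traceSum_of_mod_one {k : ℕ} (ht : Module.finrank (ZMod p) K = 3 * k + 1) (c : ZMod p) :
    traceSum χ K c = (-1) ^ (Module.finrank (ZMod p) K + 1) * (p : ℂ) ^ k *
      jacobiSum χ χ ^ k * χ c := by
  have hχ' : χ⁻¹ ≠ 1 := inv_ne_one.2 (cubic_ne_one hχ)
  have hT : ∑ y : ZMod p, ZMod.stdAddChar (-c * y) * χ⁻¹ y ^ Module.finrank (ZMod p) K =
      χ c * gaussSum χ⁻¹ ZMod.stdAddChar := by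
    rw [← cubic_neg hg hχ c]
    nth_rewrite 2 [← inv_inv χ]
    rw [← gaussSum_mulShift_eq_inv_mul hχ', gaussSum]
    refine Finset.sum_congr rfl fun y _ => ?_
    rw [AddChar.mulShift_apply, mul_comm]
    congr 1
    by_cases hy : y = 0
    · subst hy
      rw [MulChar.map_zero, zero_pow (by lia)]
    · rw [ht, pow_succ, pow_mul, cubic_inv_apply_pow_three hg hχ hy, one_pow, one_mul]
  have h := natCast_mul_traceSum K (cubic_ne_one hχ) c
  rw [hT] at h
  apply mul_left_cancel₀ (natCast_ne_zero_complex (p := p))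
  rw [h]
  nth_rewrite 2 [ht]
  rw [pow_succ (gaussSum _ _), pow_mul (gaussSum _ _), gaussSum_cubic_pow_three hg hχ]
  linear_combination (-1) ^ (Module.finrank (ZMod p) K + 1) * ((p : ℂ) * jacobiSum χ χ) ^ k * χ c *
    gaussSum_cubic_mul_inv hg hχ

include hg hχ in
theorem traceSum_of_mod_two {k : ℕ} (ht : Module.finrank (ZMod p) K = 3 * k + 2) (c : ZMod p) :
    traceSum χ K c = (-1) ^ (Module.finrank (ZMod p) K + 1) * (p : ℂ) ^ k *
      jacobiSum χ χ ^ (k + 1) * χ c ^ 2 := by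
  have hT : ∑ y : ZMod p, ZMod.stdAddChar (-c * y) * χ⁻¹ y ^ Module.finrank (ZMod p) K =
      χ c ^ 2 * gaussSum χ ZMod.stdAddChar := by
    rw [← cubic_neg hg hχ c, ← MulChar.pow_apply' _ (by norm_num), ← cubic_inv hg hχ,
      ← gaussSum_mulShift_eq_inv_mul (cubic_ne_one hχ), gaussSum]
    refine Finset.sum_congr rfl fun y _ => ?_
    rw [AddChar.mulShift_apply, mul_comm]
    congr 1
    by_cases hy : y = 0
    · subst hy
      rw [MulChar.map_zero, MulChar.map_zero, zero_pow (by lia)]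
    · rw [ht, pow_add, pow_mul, cubic_inv_apply_pow_three hg hχ hy, one_pow, one_mul,
        cubic_inv hg hχ, MulChar.pow_apply' _ (by norm_num)]
      linear_combination χ y * cubic_apply_pow_three hg hχ hy
  have h := natCast_mul_traceSum K (cubic_ne_one hχ) c
  rw [hT] at h
  apply mul_left_cancel₀ (natCast_ne_zero_complex (p := p))
  rw [h]
  nth_rewrite 2 [ht]
  rw [pow_add (gaussSum _ _), pow_mul (gaussSum _ _), gaussSum_cubic_pow_three hg hχ]
  linear_combination (-1) ^ (Module.finrank (ZMod p) K + 1) * ((p : ℂ) * jacobiSum χ χ) ^ k *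
    χ c ^ 2 * gaussSum_cubic_pow_three hg hχ

end Field
end Counting

/-! ### Elements of an intermediate field and irreducible polynomials -/

section Solutions
variable {p : ℕ} [Fact p.Prime] {g : (ZMod p)ˣ} (hg : ∀ x : (ZMod p)ˣ, x ∈ Subgroup.zpowers g)
  {χ : MulChar (ZMod p) ℂ} (hχ : χ (g : ZMod p) = zeta)

include hg hχ in
theorem mem_coset_iff {b : ZMod p} {h : ℕ} : b ∈ coset g 3 h ↔ χ b = zeta ^ h := by
  constructor
  · rintro ⟨u, hu, rfl⟩
    obtain ⟨k, rfl⟩ := mem_powers_iff_mem_zpowers.2 hu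
    simp only [Units.val_mul, Units.val_pow_eq_pow_val, map_mul, map_pow, hχ, zeta_pow_three,
      one_pow, mul_one]
  · intro hb
    have hb0 : b ≠ 0 := by
      rintro rfl
      rw [χ.map_zero] at hb
      exact pow_ne_zero h zeta_ne_zero hb.symm
    obtain ⟨k, rfl⟩ := exists_pow_eq_of_ne_zero hg hb0
    rw [map_pow, hχ, zeta_pow_eq_zeta_pow_iff] at hb
    have hdvd : (3 : ℤ) ∣ (k : ℤ) - h := by lia
    obtain ⟨l, hl⟩ := hdvd
    refine ⟨(g ^ 3) ^ l, ⟨l, rfl⟩, ?_⟩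
    rw [← Units.val_pow_eq_pow_val, Units.val_inj, ← zpow_natCast g 3, ← zpow_mul,
      ← zpow_natCast g h, ← zpow_add, ← zpow_natCast g k]
    congr 1
    push_cast
    lia

include hg hχ in
theorem conj_cubic_inv {x : ZMod p} (hx : x ≠ 0) : (starRingEnd ℂ) (χ x⁻¹) = χ x := by
  rw [conj_cubic hg hχ, ← MulChar.inv_apply', cubic_inv hg hχ, MulChar.pow_apply' _ (by norm_num)]
  linear_combination χ x * cubic_apply_pow_three hg hχ hx

include hg hχ in
theorem cubic_neg_inv {x : ZMod p} : χ (-x⁻¹) = χ x ^ 2 := by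
  rw [cubic_neg hg hχ, ← MulChar.inv_apply', cubic_inv hg hχ, MulChar.pow_apply' _ (by norm_num)]

include hg hχ in
theorem zeta_pow_mul_traceSum_eq_QThree (K : Type*) [Field K] [Fintype K] [Algebra (ZMod p) K]
    {t : ℕ} (ht : Module.finrank (ZMod p) K = t) (ht3 : t % 3 ≠ 0) {c : ZMod p} (hc : c ≠ 0)
    (i : ℕ) : zeta ^ (2 * i) * traceSum χ K c =
      (((-1) ^ (t + 1) : ℝ) : ℂ) * QThree χ (jacobiSum χ χ) t (-c⁻¹) i := by
  push_cast
  by_cases h1 : t % 3 = 1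
  · obtain ⟨k, rfl⟩ : ∃ k, t = 3 * k + 1 := ⟨t / 3, by lia⟩
    rw [traceSum_of_mod_one hg hχ K ht, ht, QThree, if_pos h1, cubic_neg hg hχ,
      conj_cubic_inv hg hχ hc, show (3 * k + 1 - 1) / 3 = k by lia]
    ring
  · obtain ⟨k, rfl⟩ : ∃ k, t = 3 * k + 2 := ⟨t / 3, by lia⟩
    rw [traceSum_of_mod_two hg hχ K ht, ht, QThree, if_neg h1, cubic_neg_inv hg hχ,
      show (3 * k + 2 - 2) / 3 = k by lia, show (3 * k + 2 + 1) / 3 = k + 1 by lia]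
    ring

include hg hχ in
theorem traceSum_zero_eq_zero (K : Type*) [Field K] [Fintype K] [Algebra (ZMod p) K]
    (ht : Module.finrank (ZMod p) K % 3 ≠ 0) : traceSum χ K 0 = 0 := by
  by_cases h1 : Module.finrank (ZMod p) K % 3 = 1
  · rw [traceSum_of_mod_one hg hχ K (k := Module.finrank (ZMod p) K / 3) (by lia), χ.map_zero,
      mul_zero]
  · rw [traceSum_of_mod_two hg hχ K (k := Module.finrank (ZMod p) K / 3) (by lia), χ.map_zero]
    ring

include hg hχ in
/-- For `x` in an intermediate field `E` of degree `t` the trace and norm from `L` are the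
`m / t`-th multiple and the `m / t`-th power of the trace and norm from `E`. -/
theorem numSol_eq {L : Type*} [Field L] [Algebra (ZMod p) L] [FiniteDimensional (ZMod p) L]
    (E : IntermediateField (ZMod p) L) (a : ZMod p) (h : ℕ) :
    numSol g E a 3 h = {x : E | (Module.finrank E L : ZMod p) * Algebra.trace (ZMod p) E x = a ∧
      χ (Algebra.norm (ZMod p) x) ^ Module.finrank E L = zeta ^ h}.ncard := by
  rw [numSol, ← Set.ncard_image_of_injective _ (Subtype.val_injective (p := (· ∈ E)))]
  congr 1
  ext x
  have htr : ∀ y : E, Algebra.trace (ZMod p) L (y : L) =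
      Module.finrank E L * Algebra.trace (ZMod p) E y := fun y => by
    rw [← Algebra.trace_trace (S := E), ← IntermediateField.algebraMap_apply,
      Algebra.trace_algebraMap, map_nsmul, nsmul_eq_mul]
  have hno : ∀ y : E, Algebra.norm (ZMod p) (y : L) =
      Algebra.norm (ZMod p) y ^ Module.finrank E L := fun y => by
    rw [← Algebra.norm_norm (S := E), ← IntermediateField.algebraMap_apply,
      Algebra.norm_algebraMap, map_pow]
  simp only [solSet, Set.mem_image, Set.mem_ofPred_eq, mem_coset_iff hg hχ]
  constructor
  · rintro ⟨hx, h1, h2⟩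
    refine ⟨⟨x, hx⟩, ⟨?_, ?_⟩, rfl⟩
    · rw [← htr, ← h1]
    · rw [← map_pow, ← hno, ← h2]
  · rintro ⟨y, ⟨h1, h2⟩, rfl⟩
    refine ⟨y.2, ?_, ?_⟩
    · rw [htr, h1]
    · rw [hno, map_pow, h2]

include hg hχ in
theorem numSol_eq_of_parD_one {L : Type*} [Field L] [Algebra (ZMod p) L]
    [FiniteDimensional (ZMod p) L] (E : IntermediateField (ZMod p) L) (a : ZMod p) (h i₀ : ℕ)
    (hM : (Module.finrank E L : ZMod p) ≠ 0) (hM3 : ¬ 3 ∣ Module.finrank E L)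
    (hi : Module.finrank E L * i₀ ≡ h [MOD 3]) :
    numSol g E a 3 h = {x : E | Algebra.trace (ZMod p) E x = a / Module.finrank E L ∧
      χ (Algebra.norm (ZMod p) x) = zeta ^ i₀}.ncard := by
  rw [numSol_eq hg hχ]
  congr 1
  ext x
  simp only [Set.mem_ofPred_eq]
  rw [eq_div_iff hM, mul_comm]
  refine and_congr_right fun _ => ?_
  by_cases hx : Algebra.norm (ZMod p) x = 0
  · rw [hx, χ.map_zero, zero_pow Module.finrank_pos.ne']
    exact ⟨fun h0 => absurd h0.symm (pow_ne_zero _ zeta_ne_zero),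
      fun h0 => absurd h0.symm (pow_ne_zero _ zeta_ne_zero)⟩
  · obtain ⟨j, -, hj⟩ := isPrimitiveRoot_zeta.eq_pow_of_pow_eq_one (cubic_apply_pow_three hg hχ hx)
    rw [← hj, ← pow_mul, zeta_pow_eq_zeta_pow_iff, zeta_pow_eq_zeta_pow_iff]
    have hcop : Nat.gcd 3 (Module.finrank E L) = 1 :=
      (Nat.Prime.coprime_iff_not_dvd Nat.prime_three).2 hM3
    constructor
    · intro h1
      refine Nat.ModEq.cancel_left_of_coprime (c := Module.finrank E L) hcop ?_
      rw [mul_comm]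
      exact Nat.ModEq.trans h1 hi.symm
    · intro h1
      rw [mul_comm]
      exact ((Nat.ModEq.refl _).mul h1).trans hi

include hg hχ in
theorem numSol_eq_of_three_dvd {L : Type*} [Field L] [Algebra (ZMod p) L]
    [FiniteDimensional (ZMod p) L] (E : IntermediateField (ZMod p) L) (a : ZMod p)
    (hM : (Module.finrank E L : ZMod p) ≠ 0) (hM3 : 3 ∣ Module.finrank E L) :
    numSol g E a 3 0 = {x : E | Algebra.trace (ZMod p) E x = a / Module.finrank E L ∧
      x ≠ 0}.ncard := by
  rw [numSol_eq hg hχ]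
  congr 1
  ext x
  simp only [Set.mem_ofPred_eq]
  rw [eq_div_iff hM, mul_comm]
  refine and_congr_right fun _ => ?_
  rw [← Algebra.norm_ne_zero_iff (R := ZMod p), pow_zero]
  by_cases hx : Algebra.norm (ZMod p) x = 0
  · rw [hx, χ.map_zero, zero_pow Module.finrank_pos.ne']
    simp
  · obtain ⟨k, hk⟩ := hM3
    rw [hk, pow_mul, cubic_apply_pow_three hg hχ hx, one_pow]
    simp [hx]

include hg hχ in
/-- The values of `N_t`. -/
theorem numSol_values {m h : ℕ} (hm : 2 ≤ m) (hh : h < 3) (a : ZMod p)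
    {L : Type*} [Field L] [Algebra (ZMod p) L] (hL : Module.finrank (ZMod p) L = m)
    {t : ℕ} (htm : t ∣ m) {E : IntermediateField (ZMod p) L}
    (hE : Module.finrank (ZMod p) E = t) (hpM : ¬ p ∣ m / t) (hdh : parD m t 3 ∣ h)
    {i₀ : ℕ} (hi₀ : IsBaseIndex m t 3 h i₀) :
    ((parD m t 3, parL m t 3) = (1, 1) ∨ (parD m t 3, parL m t 3) = (1, 3) ∨
        (parD m t 3, parL m t 3) = (3, 1)) ∧
      (a = 0 →
        ((parD m t 3, parL m t 3) = (1, 1) →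
          (numSol g E a 3 h : ℝ) = 1 / 3 * ((p : ℝ) ^ (t - 1) - 1)) ∧
        ((parD m t 3, parL m t 3) = (1, 3) →
          (numSol g E a 3 h : ℝ) = 1 / 3 * ((p : ℝ) ^ (t - 1) - 1
            - 2 * (-1) ^ t * (p : ℝ) ^ ((t - 3) / 3) * ((p : ℝ) - 1) *
              (jacobiSum χ χ ^ (t / 3) * zeta ^ (2 * i₀)).re)) ∧
        ((parD m t 3, parL m t 3) = (3, 1) →
          (numSol g E a 3 h : ℝ) = (p : ℝ) ^ (t - 1) - 1)) ∧
      (a ≠ 0 →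
        ((parD m t 3, parL m t 3) = (1, 1) →
          (numSol g E a 3 h : ℝ) = 1 / 3 * ((p : ℝ) ^ (t - 1)
            - 2 * (-1) ^ t * (QThree χ (jacobiSum χ χ) t (aZero m t a) i₀).re)) ∧
        ((parD m t 3, parL m t 3) = (1, 3) →
          (numSol g E a 3 h : ℝ) = 1 / 3 * ((p : ℝ) ^ (t - 1)
            + 2 * (-1) ^ t * (p : ℝ) ^ ((t - 3) / 3) *
              (jacobiSum χ χ ^ (t / 3) * zeta ^ (2 * i₀)).re)) ∧
        ((parD m t 3, parL m t 3) = (3, 1) →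
          (numSol g E a 3 h : ℝ) = (p : ℝ) ^ (t - 1))) := by
  have : FiniteDimensional (ZMod p) L := Module.finite_of_finrank_pos (by lia)
  have : Finite L := Module.finite_of_finite (ZMod p)
  let _ : Fintype E := Fintype.ofFinite E
  have htpos : 0 < t := hE ▸ Module.finrank_pos
  have hM : m / t = Module.finrank E L := by
    rw [← hL, ← Module.finrank_mul_finrank (ZMod p) E L, hE, Nat.mul_div_cancel_left _ htpos]
  have hM0 : (Module.finrank E L : ZMod p) ≠ 0 := by
    rwa [Ne, ZMod.natCast_eq_zero_iff, ← hM]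
  have hD : parD m t 3 = 1 ∧ ¬ 3 ∣ m / t ∨ parD m t 3 = 3 ∧ 3 ∣ m / t := by
    by_cases h3 : 3 ∣ m / t
    · exact Or.inr ⟨Nat.gcd_eq_right h3, h3⟩
    · exact Or.inl ⟨((Nat.Prime.coprime_iff_not_dvd Nat.prime_three).2 h3).symm, h3⟩
  rcases hD with ⟨hd, h3⟩ | ⟨hd, h3⟩
  · have hl : parL m t 3 = Nat.gcd t 3 := by rw [parL, hd, Nat.div_one]
    have hi : Module.finrank E L * i₀ ≡ h [MOD 3] := by
      have := hi₀.2
      rwa [hd, Nat.div_one, Nat.div_one, Nat.div_one, hM] at this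
    rw [hM] at h3
    have hN := three_mul_ncard_trace_norm hg hχ E (a / Module.finrank E L) i₀
    rw [← numSol_eq_of_parD_one hg hχ E a h i₀ hM0 h3 hi, hE] at hN
    have hc : a / (Module.finrank E L : ZMod p) = 0 ↔ a = 0 := by
      rw [div_eq_zero_iff]; exact or_iff_left hM0
    rw [hd, hl]
    by_cases ht3 : 3 ∣ t
    · have hg3 : Nat.gcd t 3 = 3 := Nat.gcd_eq_right ht3
      rw [hg3]
      obtain ⟨k, rfl⟩ : ∃ k, t = 3 * (k + 1) := ⟨t / 3 - 1, by lia⟩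
      rw [traceSum_of_mod_zero hg hχ E hE, hE] at hN
      rw [show (3 * (k + 1) - 3) / 3 = k by lia, show 3 * (k + 1) / 3 = k + 1 by lia]
      refine ⟨by simp, fun ha => ⟨by simp, fun _ => ?_, by simp⟩,
        fun ha => ⟨by simp, fun _ => ?_, by simp⟩⟩
      · rw [if_pos (hc.2 ha), if_pos (hc.2 ha)] at hN
        have hr : zeta ^ (2 * i₀) * ((-1) ^ (3 * (k + 1) + 1) * (p : ℂ) ^ k *
            jacobiSum χ χ ^ (k + 1) * ((p : ℂ) - 1)) =
            (((-1) ^ (3 * (k + 1) + 1) * (p : ℝ) ^ k * ((p : ℝ) - 1) : ℝ) : ℂ) *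
            (jacobiSum χ χ ^ (k + 1) * zeta ^ (2 * i₀)) := by
          push_cast; ring
        rw [hr, Complex.re_ofReal_mul] at hN
        rw [pow_succ (-1 : ℝ) (3 * (k + 1))] at hN
        linear_combination hN / 3
      · rw [if_neg (mt hc.1 ha), if_neg (mt hc.1 ha)] at hN
        have hr : zeta ^ (2 * i₀) * ((-1) ^ (3 * (k + 1) + 1) * (p : ℂ) ^ k *
            jacobiSum χ χ ^ (k + 1) * (0 - 1)) =
            (((-1) ^ (3 * (k + 1)) * (p : ℝ) ^ k : ℝ) : ℂ) *
            (jacobiSum χ χ ^ (k + 1) * zeta ^ (2 * i₀)) := by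
          push_cast; ring
        rw [hr, Complex.re_ofReal_mul] at hN
        linear_combination hN / 3
    · have hg3 : Nat.gcd t 3 = 1 := ((Nat.Prime.coprime_iff_not_dvd Nat.prime_three).2 ht3).symm
      rw [hg3]
      refine ⟨by simp, fun ha => ⟨fun _ => ?_, by simp, by simp⟩,
        fun ha => ⟨fun _ => ?_, by simp, by simp⟩⟩
      · rw [if_pos (hc.2 ha), hc.2 ha, traceSum_zero_eq_zero hg hχ E (by rw [hE]; lia), mul_zero,
          Complex.zero_re] at hN
        linear_combination hN / 3
      · rw [if_neg (mt hc.1 ha), zeta_pow_mul_traceSum_eq_QThree hg hχ E hE (by lia) (mt hc.1 ha),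
          Complex.re_ofReal_mul, inv_div] at hN
        have ha0 : aZero m t a = -((Module.finrank E L : ZMod p) / a) := by
          rw [aZero, hM, neg_div]
        rw [ha0]
        linear_combination hN / 3
  · have hl : parL m t 3 = 1 := by rw [parL, hd]; exact Nat.gcd_one_right t
    obtain rfl : h = 0 := by rw [hd] at hdh; lia
    rw [hM] at h3
    have hN := ncard_trace_eq_ne_zero E (a / (Module.finrank E L : ZMod p))
    rw [← numSol_eq_of_three_dvd hg hχ E a hM0 h3, hE] at hN
    have hc : a / (Module.finrank E L : ZMod p) = 0 ↔ a = 0 := by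
      rw [div_eq_zero_iff]; exact or_iff_left hM0
    rw [hd, hl]
    refine ⟨by simp, fun ha => ⟨by simp, by simp, fun _ => ?_⟩,
      fun ha => ⟨by simp, by simp, fun _ => ?_⟩⟩
    · rw [hN, if_pos (hc.2 ha)]
    · rw [hN, if_neg (mt hc.1 ha), sub_zero]

end Solutions

section Irreducibles
variable {p : ℕ} [Fact p.Prime] {g : (ZMod p)ˣ} (hg : ∀ x : (ZMod p)ˣ, x ∈ Subgroup.zpowers g)
  {χ : MulChar (ZMod p) ℂ} (hχ : χ (g : ZMod p) = zeta)

include hg hχ in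
/-- Each irreducible polynomial of degree `m` counted by `numIrreducible` is the minimal polynomial
of `m` elements of the field of degree `m`; for a prime `m` these are all the elements outside the
prime field with the prescribed trace and norm. -/
theorem mul_numIrreducible_add (K : Type*) [Field K] [Fintype K] [Algebra (ZMod p) K] {m : ℕ}
    (hK : Module.finrank (ZMod p) K = m) (hm : m.Prime) (a : ZMod p) (h : ℕ) :
    m * numIrreducible g m a 3 h +
      {y : ZMod p | (m : ZMod p) * y = a ∧ χ y ^ m = zeta ^ h}.ncard =
    {x : K | Algebra.trace (ZMod p) K x = a ∧ χ (Algebra.norm (ZMod p) x) = zeta ^ h}.ncard := by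
  classical
  have hint : ∀ x : K, IsIntegral (ZMod p) x := fun x => Algebra.IsIntegral.isIntegral x
  set T : Set K := {x : K | Algebra.trace (ZMod p) K x = a ∧
    χ (Algebra.norm (ZMod p) x) = zeta ^ h} with hT
  have hdeg : ∀ x : K, x ∉ Set.range (algebraMap (ZMod p) K) →
      (minpoly (ZMod p) x).natDegree = m := by
    intro x hx
    have hd : (minpoly (ZMod p) x).natDegree ∣ m :=
      hK ▸ Dvd.intro _ (finrank_eq_natDegree_mul_finrank (ZMod p) x).symm
    refine ((Nat.dvd_prime hm).1 hd).resolve_left fun h1 => hx ?_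
    exact minpoly.natDegree_eq_one_iff.1 h1
  have htr : ∀ x : K, (minpoly (ZMod p) x).natDegree = m →
      Algebra.trace (ZMod p) K x = -(minpoly (ZMod p) x).coeff (m - 1) := by
    intro x hx
    rw [trace_eq_smul_minpoly, hK, hx, Nat.div_self hm.pos, one_smul,
      nextCoeff_of_natDegree_pos (by rw [hx]; exact hm.pos), hx]
  have hno : ∀ x : K, (minpoly (ZMod p) x).natDegree = m →
      Algebra.norm (ZMod p) x = (-1) ^ m * (minpoly (ZMod p) x).coeff 0 := by
    intro x hx
    rw [norm_eq_minpoly_pow, hK, hx, Nat.div_self hm.pos, pow_one]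
  set P : Set (ZMod p)[X] := {f : (ZMod p)[X] | f.Monic ∧ Irreducible f ∧ f.natDegree = m ∧
    f.coeff (m - 1) = -a ∧ ∃ b ∈ coset g 3 h, f.coeff 0 = (-1) ^ m * b} with hP
  have hPfin : P.Finite := (finite_monic (ZMod p) m).subset fun f hf => ⟨hf.1, hf.2.2.1⟩
  have hsq : ((-1 : ZMod p) ^ m) * (-1) ^ m = 1 := by rw [← mul_pow]; simp
  have hmem : ∀ x : K, (minpoly (ZMod p) x).natDegree = m → (x ∈ T ↔ minpoly (ZMod p) x ∈ P) := by
    intro x hx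
    simp only [hT, hP, Set.mem_ofPred_eq, htr x hx, hno x hx, mem_coset_iff hg hχ]
    constructor
    · rintro ⟨h1, h2⟩
      refine ⟨minpoly.monic (hint x), minpoly.irreducible (hint x), hx, by rw [← h1, neg_neg],
        _, h2, ?_⟩
      rw [← mul_assoc, hsq, one_mul]
    · rintro ⟨-, -, -, h1, b, hb, h2⟩
      rw [h1, h2, ← mul_assoc, hsq, one_mul, neg_neg]
      exact ⟨rfl, hb⟩
  have hfib : (T \ Set.range (algebraMap (ZMod p) K)).ncard = m * P.ncard := by
    have hfin := Set.toFinite (T \ Set.range (algebraMap (ZMod p) K))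
    rw [Set.ncard_eq_toFinset_card _ hfin, Set.ncard_eq_toFinset_card _ hPfin,
      Finset.card_eq_sum_card_fiberwise (f := minpoly (ZMod p)) (t := hPfin.toFinset)]
    · rw [Finset.sum_congr rfl (g := fun _ => m), Finset.sum_const, smul_eq_mul, mul_comm]
      intro f hf
      have hfP := hPfin.mem_toFinset.1 hf
      obtain ⟨h1, h2, h3, -⟩ := hfP
      rw [← h3, ← ncard_minpoly_eq (ZMod p) K h1 h2 (by rw [h3, hK]),
        Set.ncard_eq_toFinset_card']
      congr 1
      ext x
      rw [Finset.mem_filter, hfin.mem_toFinset, Set.mem_toFinset, Set.mem_sdiff, Set.mem_ofPred_eq]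
      refine ⟨fun hx => hx.2, fun hx => ⟨⟨?_, ?_⟩, hx⟩⟩
      · exact (hmem x (by rw [hx, h3])).2 (hx ▸ hPfin.mem_toFinset.1 hf)
      · intro hr
        have h5 := minpoly.natDegree_eq_one_iff.2 hr
        rw [hx, h3] at h5
        exact hm.one_lt.ne' h5
    · intro x hx
      obtain ⟨hx1, hx2⟩ := hfin.mem_toFinset.1 hx
      exact Finset.mem_coe.2 (hPfin.mem_toFinset.2 ((hmem x (hdeg x hx2)).1 hx1))
  have hbase : (T ∩ Set.range (algebraMap (ZMod p) K)).ncard =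
      {y : ZMod p | (m : ZMod p) * y = a ∧ χ y ^ m = zeta ^ h}.ncard := by
    rw [← Set.ncard_image_of_injective _ (algebraMap (ZMod p) K).injective]
    congr 1
    ext x
    simp only [hT, Set.mem_inter_iff, Set.mem_ofPred_eq, Set.mem_range, Set.mem_image]
    constructor
    · rintro ⟨h1, y, rfl⟩
      rw [Algebra.trace_algebraMap, Algebra.norm_algebraMap, hK, nsmul_eq_mul, map_pow] at h1
      exact ⟨y, h1, rfl⟩
    · rintro ⟨y, h1, rfl⟩
      rw [Algebra.trace_algebraMap, Algebra.norm_algebraMap, hK, nsmul_eq_mul, map_pow]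
      exact ⟨h1, y, rfl⟩
  rw [numIrreducible, ← hP, ← hfib, ← hbase, add_comm]
  exact Set.ncard_inter_add_ncard_sdiff_eq_ncard T _ (Set.toFinite _)

theorem natCast_zmod_ne_zero {m : ℕ} (hm : m.Prime) (hmp : m ≠ p) : (m : ZMod p) ≠ 0 := by
  rw [Ne, ZMod.natCast_eq_zero_iff]
  exact fun h => hmp ((Nat.prime_dvd_prime_iff_eq Fact.out hm).1 h).symm

include hg hχ in
theorem three_mul_ncard_base_eq_sub_one (hp : p ≡ 1 [MOD 3]) (h : ℕ) :
    3 * ({y : ZMod p | (p : ZMod p) * y = 0 ∧ χ y ^ p = zeta ^ h}.ncard : ℝ) = (p : ℝ) - 1 := by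
  classical
  have h7 := seven_le_of_mod_three hp
  have hpow : ∀ y, χ y ^ p = χ y := by
    intro y
    by_cases hy : y = 0
    · rw [hy, χ.map_zero, zero_pow (by lia)]
    · rw [pow_eq_pow_mod p (cubic_apply_pow_three hg hχ hy), hp, Nat.mod_eq_of_lt (by norm_num),
        pow_one]
  simp only [hpow, CharP.cast_eq_zero, zero_mul, true_and]
  rw [Set.ncard_eq_toFinset_card', Set.toFinset_ofPred, Finset.card_filter]
  push_cast
  rw [Finset.mul_sum, Finset.sum_congr rfl fun y _ => three_mul_indicator hg hχ y h,
    Finset.sum_add_distrib, ← Finset.mul_sum, ← Complex.re_sum, ← Finset.mul_sum,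
    MulChar.sum_eq_zero_of_ne_one (cubic_ne_one hχ), mul_zero, Complex.zero_re, mul_zero, add_zero,
    Finset.sum_ite, Finset.sum_const_zero, zero_add, Finset.sum_const, nsmul_eq_mul, mul_one]
  have h4 : (Finset.univ.filter fun v : ZMod p => ¬ v = 0) = Finset.univ.erase 0 := by
    ext v; simp
  rw [h4, Finset.card_erase_of_mem (Finset.mem_univ _), Finset.card_univ, ZMod.card,
    Nat.cast_sub (by lia), Nat.cast_one]

include hg hχ in
theorem three_mul_ncard_base {m : ℕ} (hm : (m : ZMod p) ≠ 0) {a : ZMod p} (ha : a ≠ 0) (h : ℕ) :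
    3 * ({y : ZMod p | (m : ZMod p) * y = a ∧ χ y ^ m = zeta ^ h}.ncard : ℝ) =
      1 + 2 * (zeta ^ (2 * h) * χ (a / m) ^ m).re := by
  classical
  have hv := three_mul_indicator hg hχ ((a / m) ^ m) h
  rw [if_neg (pow_ne_zero m (div_ne_zero ha hm)), map_pow] at hv
  rw [← hv]
  congr 1
  have hset : {y : ZMod p | (m : ZMod p) * y = a ∧ χ y ^ m = zeta ^ h} =
      if χ (a / m) ^ m = zeta ^ h then {a / (m : ZMod p)} else ∅ := by
    ext y
    rw [Set.mem_ofPred_eq, mul_comm, ← eq_div_iff hm]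
    split_ifs with h1
    · rw [Set.mem_singleton_iff]
      exact ⟨fun h2 => h2.1, fun h2 => ⟨h2, h2 ▸ h1⟩⟩
    · refine ⟨fun h2 => h1 (h2.1 ▸ h2.2), fun h2 => h2.elim⟩
  rw [hset]
  split_ifs <;> simp

include hg hχ in
/-- The values of `P_m(a, 3, h)` for a prime `m > 3`. -/
theorem numIrreducible_values (hp : p ≡ 1 [MOD 3]) {m : ℕ} (hm : m.Prime) (hm3 : 3 < m) (h : ℕ)
    (a : ZMod p) :
      (a = 0 →
        (m = p → (numIrreducible g m a 3 h : ℝ) = 1 / 3 * ((p : ℝ) ^ (p - 2) - 1)) ∧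
        (m ≠ p →
          (numIrreducible g m a 3 h : ℝ) =
            1 / (3 * (m : ℝ)) * ((p : ℝ) ^ (m - 1) - 1))) ∧
      (a ≠ 0 →
        (m = p →
          (numIrreducible g m a 3 h : ℝ) = 1 / (3 * (p : ℝ)) * ((p : ℝ) ^ (p - 1)
            + 2 * (p : ℝ) ^ ((p - 1) / 3) *
              (jacobiSum χ χ ^ ((p - 1) / 3) * χ a * zeta ^ (2 * h)).re)) ∧
        (m ≠ p →
          (numIrreducible g m a 3 h : ℝ) = 1 / (3 * (m : ℝ)) * ((p : ℝ) ^ (m - 1) - 1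
            + 2 * (LThree χ (jacobiSum χ χ) m a h).re))) := by
  let _ : Fintype (GaloisField p m) := Fintype.ofFinite _
  have h7 := seven_le_of_mod_three hp
  have hm0 : (m : ℝ) ≠ 0 := Nat.cast_ne_zero.2 hm.ne_zero
  have hK : Module.finrank (ZMod p) (GaloisField p m) = m := GaloisField.finrank p hm.ne_zero
  have hmod : m % 3 ≠ 0 := fun h3 =>
    hm3.ne ((Nat.prime_dvd_prime_iff_eq Nat.prime_three hm).1 (Nat.dvd_of_mod_eq_zero h3))
  have hsgn : (-1 : ℂ) ^ (m + 1) = 1 :=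
    ((hm.odd_of_ne_two (by lia)).add_odd odd_one).neg_one_pow
  have hcount : 3 * ((m : ℝ) * numIrreducible g m a 3 h) =
      (p : ℝ) ^ (m - 1) - (if a = 0 then 1 else 0) +
      2 * (zeta ^ (2 * h) * traceSum χ (GaloisField p m) a).re
      - 3 * ({y : ZMod p | (m : ZMod p) * y = a ∧ χ y ^ m = zeta ^ h}.ncard : ℝ) := by
    have h1 := three_mul_ncard_trace_norm hg hχ (GaloisField p m) a h
    rw [← mul_numIrreducible_add hg hχ (GaloisField p m) hK hm a h, hK] at h1
    push_cast at h1
    linear_combination h1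
  refine ⟨fun ha => ⟨fun hmp => ?_, fun hmp => ?_⟩, fun ha => ⟨fun hmp => ?_, fun hmp => ?_⟩⟩
  · subst ha hmp
    rw [traceSum_zero_eq_zero hg hχ _ (by rw [hK]; exact hmod), if_pos rfl, mul_zero,
      Complex.zero_re, three_mul_ncard_base_eq_sub_one hg hχ hp,
      show m - 1 = m - 2 + 1 by lia, pow_succ] at hcount
    apply mul_left_cancel₀ hm0
    linear_combination hcount / 3
  · subst ha
    have hempty : {y : ZMod p | (m : ZMod p) * y = 0 ∧ χ y ^ m = zeta ^ h} = ∅ := by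
      ext y
      simp only [Set.mem_ofPred_eq, Set.mem_empty_iff_false, iff_false, not_and]
      intro hy
      rw [(mul_eq_zero.1 hy).resolve_left (natCast_zmod_ne_zero hm hmp), χ.map_zero,
        zero_pow hm.ne_zero]
      exact (pow_ne_zero h zeta_ne_zero).symm
    rw [traceSum_zero_eq_zero hg hχ _ (by rw [hK]; exact hmod), if_pos rfl, mul_zero,
      Complex.zero_re, hempty, Set.ncard_empty] at hcount
    field_simp
    linear_combination hcount
  · subst hmp
    have hempty : {y : ZMod m | (m : ZMod m) * y = a ∧ χ y ^ m = zeta ^ h} = ∅ := by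
      ext y
      simp only [Set.mem_ofPred_eq, Set.mem_empty_iff_false, iff_false, not_and]
      intro hy
      rw [CharP.cast_eq_zero, zero_mul] at hy
      exact absurd hy.symm ha
    rw [if_neg ha, hempty, Set.ncard_empty, traceSum_of_mod_one hg hχ _ (k := (m - 1) / 3)
      (by rw [hK, three_mul_div hp]; lia), hK, hsgn] at hcount
    have hr : zeta ^ (2 * h) * (1 * (m : ℂ) ^ ((m - 1) / 3) * jacobiSum χ χ ^ ((m - 1) / 3) * χ a) =
        (((m : ℝ) ^ ((m - 1) / 3) : ℝ) : ℂ) *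
          (jacobiSum χ χ ^ ((m - 1) / 3) * χ a * zeta ^ (2 * h)) := by
      push_cast; ring
    rw [hr, Complex.re_ofReal_mul] at hcount
    field_simp
    linear_combination hcount
  · have hmz := natCast_zmod_ne_zero hm hmp
    rw [if_neg ha, three_mul_ncard_base hg hχ hmz ha] at hcount
    have hχa := cubic_apply_pow_three hg hχ ha
    have hχm := cubic_apply_pow_three hg hχ hmz
    have hdiv : χ (a / m) = χ a * χ m ^ 2 := by
      rw [div_eq_mul_inv, map_mul, ← MulChar.inv_apply', cubic_inv hg hχ,
        MulChar.pow_apply' _ (by norm_num)]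
    have key : (LThree χ (jacobiSum χ χ) m a h).re =
        (zeta ^ (2 * h) * traceSum χ (GaloisField p m) a).re -
          (zeta ^ (2 * h) * χ (a / m) ^ m).re := by
      by_cases h1 : m % 3 = 1
      · rw [← Complex.sub_re, LThree, if_pos h1, traceSum_of_mod_one hg hχ _ (k := (m - 1) / 3)
          (by rw [hK]; lia), hK, hsgn, conj_cubic hg hχ,
          pow_eq_pow_mod m (cubic_apply_pow_three hg hχ (div_ne_zero ha hmz)), h1, hdiv]
        congr 1
        ring
      · -- `LThree` contains the complex conjugate of the contribution of the prime field.
        have h2 : m % 3 = 2 := by lia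
        have hconj : (zeta ^ (2 * h) * χ (a / m) ^ m).re = (zeta ^ h * χ a * χ m ^ 2).re := by
          rw [← Complex.conj_re, pow_eq_pow_mod m
            (cubic_apply_pow_three hg hχ (div_ne_zero ha hmz)), h2, hdiv]
          simp only [map_mul, map_pow, conj_zeta, conj_cubic hg hχ]
          congr 1
          have hz : (zeta ^ 2) ^ (2 * h) = zeta ^ h := by
            rw [← pow_mul, zeta_pow_eq_zeta_pow_iff]; lia
          rw [hz]
          -- The exponents of `χ a` and `χ m` agree modulo `3`.
          linear_combination zeta ^ h * χ a * χ m ^ 2 * hχa * (χ m ^ 6) +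
            zeta ^ h * χ a * χ m ^ 2 * (χ m ^ 3 + 1) * hχm
        rw [hconj, ← Complex.sub_re, LThree, if_neg h1,
          traceSum_of_mod_two hg hχ _ (k := (m - 2) / 3) (by rw [hK]; lia), hK, hsgn,
          conj_cubic hg hχ, show (m + 1) / 3 = (m - 2) / 3 + 1 by lia]
        congr 1
        ring
    rw [key]
    field_simp
    linear_combination hcount

end Irreducibles

end NormTrace

end

theorem mainTheorem3
    (p : ℕ) [Fact p.Prime] (hp : p ≡ 1 [MOD 3])
    (g : (ZMod p)ˣ) (hg : ∀ x : (ZMod p)ˣ, x ∈ Subgroup.zpowers g)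
    (χ : MulChar (ZMod p) ℂ) (hχ : χ (g : ZMod p) = NormTrace.zeta)
    (a₃ b₃ : ℤ) (hab : a₃ ^ 2 + 3 * b₃ ^ 2 = (p : ℤ)) (ha₃ : a₃ ≡ -1 [ZMOD 3])
    (hb₃ : 3 * (b₃ : ZMod p) = (2 * (g : ZMod p) ^ ((p - 1) / 3) + 1) * (a₃ : ZMod p))
    (m : ℕ) (hm : 2 ≤ m) (h : ℕ) (hh : h < 3) (a : ZMod p) :
    -- the values of `N_t`
    (∀ (L : Type*) [Field L] [Algebra (ZMod p) L], Module.finrank (ZMod p) L = m →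
      ∀ t : ℕ, t ∣ m → ∀ E : IntermediateField (ZMod p) L, Module.finrank (ZMod p) E = t →
      ¬ p ∣ m / t → NormTrace.parD m t 3 ∣ h →
      ∀ i₀ : ℕ, NormTrace.IsBaseIndex m t 3 h i₀ →
      ((NormTrace.parD m t 3, NormTrace.parL m t 3) = (1, 1) ∨
        (NormTrace.parD m t 3, NormTrace.parL m t 3) = (1, 3) ∨
        (NormTrace.parD m t 3, NormTrace.parL m t 3) = (3, 1)) ∧
      (a = 0 →
        ((NormTrace.parD m t 3, NormTrace.parL m t 3) = (1, 1) →
          (NormTrace.numSol g E a 3 h : ℝ) = 1 / 3 * ((p : ℝ) ^ (t - 1) - 1)) ∧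
        ((NormTrace.parD m t 3, NormTrace.parL m t 3) = (1, 3) →
          (NormTrace.numSol g E a 3 h : ℝ) = 1 / 3 * ((p : ℝ) ^ (t - 1) - 1
            - 2 * (-1) ^ t * (p : ℝ) ^ ((t - 3) / 3) * ((p : ℝ) - 1) *
              (NormTrace.piThree χ a₃ b₃ ^ (t / 3) * NormTrace.zeta ^ (2 * i₀)).re)) ∧
        ((NormTrace.parD m t 3, NormTrace.parL m t 3) = (3, 1) →
          (NormTrace.numSol g E a 3 h : ℝ) = (p : ℝ) ^ (t - 1) - 1)) ∧
      (a ≠ 0 →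
        ((NormTrace.parD m t 3, NormTrace.parL m t 3) = (1, 1) →
          (NormTrace.numSol g E a 3 h : ℝ) = 1 / 3 * ((p : ℝ) ^ (t - 1)
            - 2 * (-1) ^ t * (NormTrace.QThree χ (NormTrace.piThree χ a₃ b₃) t
                (NormTrace.aZero m t a) i₀).re)) ∧
        ((NormTrace.parD m t 3, NormTrace.parL m t 3) = (1, 3) →
          (NormTrace.numSol g E a 3 h : ℝ) = 1 / 3 * ((p : ℝ) ^ (t - 1)
            + 2 * (-1) ^ t * (p : ℝ) ^ ((t - 3) / 3) *
              (NormTrace.piThree χ a₃ b₃ ^ (t / 3) * NormTrace.zeta ^ (2 * i₀)).re)) ∧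
        ((NormTrace.parD m t 3, NormTrace.parL m t 3) = (3, 1) →
          (NormTrace.numSol g E a 3 h : ℝ) = (p : ℝ) ^ (t - 1)))) ∧
    -- the values of `P_m(a, 3, h)` for a prime `m > 3`
    (m.Prime → 3 < m →
      (a = 0 →
        (m = p → (NormTrace.numIrreducible g m a 3 h : ℝ) = 1 / 3 * ((p : ℝ) ^ (p - 2) - 1)) ∧
        (m ≠ p →
          (NormTrace.numIrreducible g m a 3 h : ℝ) =
            1 / (3 * (m : ℝ)) * ((p : ℝ) ^ (m - 1) - 1))) ∧
      (a ≠ 0 →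
        (m = p →
          (NormTrace.numIrreducible g m a 3 h : ℝ) = 1 / (3 * (p : ℝ)) * ((p : ℝ) ^ (p - 1)
            + 2 * (p : ℝ) ^ ((p - 1) / 3) *
              (NormTrace.piThree χ a₃ b₃ ^ ((p - 1) / 3) * χ a * NormTrace.zeta ^ (2 * h)).re)) ∧
        (m ≠ p →
          (NormTrace.numIrreducible g m a 3 h : ℝ) = 1 / (3 * (m : ℝ)) * ((p : ℝ) ^ (m - 1) - 1
            + 2 * (NormTrace.LThree χ (NormTrace.piThree χ a₃ b₃) m a h).re)))) := by
  rw [← NormTrace.jacobiSum_eq_piThree hg hχ hp hab ha₃ hb₃]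
  refine ⟨?_, fun hmp hm3 => NormTrace.numIrreducible_values hg hχ hp hmp hm3 h a⟩
  intro L _ _ hL t htm E hE hpM hdh i₀ hi₀
  exact NormTrace.numSol_values hg hχ hm hh a hL htm hE hpM hdh hi₀
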